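/- Conventions. For a valued field $K$ with valuation ring $\mathcal O_K$, write $|\cdot|$ for the valuation (multiplicative notation), $\Gamma_K^\times$ for the value group, and $B_{<\lambda}(a)=\{x : |x-a|<\lambda\}$, $B_{\le\lambda}(a)=\{x : |x-a|\le\lambda\}$ for the open and closed balls ($a\in K$, $\lambda\in\Gamma_K^\times$). $K$ is *spherically complete* if every chain of (open or closed) balls has non-empty intersection. For $\lambda\le 1$ in $\Gamma_K^\times$ let $\mathrm{RV}_{\lambda,K}=(K^\times/B_{<\lambda}(1))\cup\{0\}$, with canonical map $\mathrm{rv}_\lambda\colon K\to \mathrm{RV}_{\lambda,K}$, $\mathrm{rv}_\lambda(0)=0$. A set $C\subseteq K$ *$\lambda$-prepares* $X\subseteq K$ if, for all $x,x'\in K$ with $\mathrm{rv}_\lambda(x-c)=\mathrm{rv}_\lambda(x'-c)$ for all $c\in C$, one has $x\in X\iff x'\in X$. If the residue characteristic is a prime $p$, $K$ is *finitely ramified* if $\{\gamma\in\Gamma_K^\times : |p|\le\gamma\le 1\}$ is finite. Let $L$ be a one-sorted first-order language expanding the valued field language (the ring language together with a unary predicate for the valuation ring); definability refers to $L$, with the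 $\mathrm{RV}_{|n|}$ regarded as imaginary sorts. Let $T$ be the complete $L$-theory of a valued field of characteristic $0$. If the residue characteristic is $0$, $T$ is *$0$-h-minimal* if for every model $N$ of $T$ and every $A\subseteq N$, every $(A\cup \mathrm{RV}_{1,N})$-definable set $X\subseteq N$ is $1$-prepared by some finite $A$-definable set $C\subseteq N$. $T$ is *$0$-h$^{\mathrm{mix}}$-minimal* if for every model $N$ of $T$, every $A\subseteq N$ and every integer $n\ge 1$, every $(A\cup \mathrm{RV}_{|n|,N})$-definable set $X\subseteq N$ is $|m|$-prepared by some finite $A$-definable set $C\subseteq N$, for some integer $m\ge 1$. An $L$-structure $M$ is *$\kappa$-saturated* if for every $A\subseteq M$ of cardinality less than $\kappa$, every set of $L$-formulas in one variable with parameters from $A$ that is finitely satisfiable in $M$ is realized in $M$. Corollary. Let $K$ be a valued field of characteristic $0$, considered as a structure in a language $L$ expanding the valued field language, such that either (1) the residue characteristic of $K$ is $0$ and $\mathrm{Th}(K)$ is $0$-h-minimal; or (2) $K$ is finitely ramified, of finite residue characteristic, and $\mathrm{Th}(K)$ is $0$-h$^{\mathrm{mix}}$-minimal. Then for every cardinal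 $\kappa$, $K$ has an elementary extension that is $\kappa$-saturated and spherically complete. -/

import Mathlib

open FirstOrder Cardinal

universe u v w

namespace HenselMin

/-- The relation symbols of the valued field language: one unary predicate. -/
inductive ValRel : ℕ → Type
  | integer : ValRel 1

/-- The language of valued fields: the language of rings together with a unary predicate for the
valuation ring. -/
def valLanguage : FirstOrder.Language.{0, 0} where
  Functions := ringFunc
  Relations := ValRel

section ValuedField

variable {K : Type w} [Field K]

/-- The subgroup `B_{<r}(1)` of `Kˣ`. For `0 < r ≤ 1` the set `{u | |u - 1| < r}` is already a
subgroup, see `mem_ballOne_iff`. -/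
def ballOne (V : ValuationSubring K) (r : V.ValueGroup) : Subgroup Kˣ :=
  Subgroup.closure {x : Kˣ | V.valuation ((x : K) - 1) < r}

/-- The leading term structure `RV_r = (Kˣ / B_{<r}(1)) ∪ {0}`. -/
abbrev RV (V : ValuationSubring K) (r : V.ValueGroup) : Type w :=
  WithZero (Kˣ ⧸ ballOne V r)

open Classical in
/-- The canonical map `rv_r : K → RV_r`. -/
noncomputable def rv (V : ValuationSubring K) (r : V.ValueGroup) (x : K) : RV V r :=
  if h : x = 0 then 0 else ((QuotientGroup.mk (Units.mk0 x h) : Kˣ ⧸ ballOne V r) : RV V r)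

theorem mem_ballOne_iff (V : ValuationSubring K) {r : V.ValueGroup} (h0 : 0 < r) (h1 : r ≤ 1)
    (x : Kˣ) : x ∈ ballOne V r ↔ V.valuation ((x : K) - 1) < r := by
  have key : ∀ y : Kˣ, V.valuation ((y : K) - 1) < r → V.valuation (y : K) = 1 := by
    intro y hy
    have := V.valuation.map_one_add_of_lt (x := (y : K) - 1) (hy.trans_le h1)
    simpa using this
  refine ⟨fun hx => ?_, fun hx => Subgroup.subset_closure hx⟩
  induction hx using Subgroup.closure_induction with
  | mem y hy => exact hy
  | one => simpa using h0
  | mul y z _ _ hy hz =>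
    have e : ((y * z : Kˣ) : K) - 1 = (y : K) * ((z : K) - 1) + ((y : K) - 1) := by
      push_cast; ring
    rw [e]
    refine V.valuation.map_add_lt ?_ hy
    rw [map_mul, key y hy, one_mul]
    exact hz
  | inv y _ hy =>
    have e : ((y⁻¹ : Kˣ) : K) - 1 = -(((y⁻¹ : Kˣ) : K) * ((y : K) - 1)) := by
      rw [mul_sub, Units.inv_mul]; ring
    rw [e, Valuation.map_neg, map_mul, Units.val_inv_eq_inv_val, map_inv₀, key y hy, inv_one,
      one_mul]
    exact hy

/-- Equality of leading terms in terms of the valuation. -/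
theorem rv_eq_rv_iff (V : ValuationSubring K) {r : V.ValueGroup} (h0 : 0 < r) (h1 : r ≤ 1)
    (x y : K) : rv V r x = rv V r y ↔ x = y ∨ V.valuation (x - y) < r * V.valuation x := by
  by_cases hx : x = 0
  · by_cases hy : y = 0
    · simp [hx, hy]
    · simp [rv, hx, hy, eq_comm]
  · by_cases hy : y = 0
    · subst hy
      have hv : V.valuation x ≠ 0 := by simpa using hx
      have : r * V.valuation x ≤ V.valuation x := mul_le_of_le_one_left' h1
      simp [rv, hx, this]
    · have hv : 0 < V.valuation x := by simpa [zero_lt_iff] using hx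
      have e : y * x⁻¹ - 1 = -((x - y) * x⁻¹) := by field_simp; ring
      have e2 : V.valuation (y * x⁻¹ - 1) < r ↔ V.valuation (x - y) < r * V.valuation x := by
        rw [e, Valuation.map_neg, map_mul, map_inv₀, ← div_eq_mul_inv, div_lt_iff₀ hv]
      have e3 : rv V r x = rv V r y ↔ V.valuation (x - y) < r * V.valuation x := by
        simp only [rv, hx, hy, dite_false, WithZero.coe_inj]
        rw [QuotientGroup.eq, mem_ballOne_iff V h0 h1, ← e2]
        simp [mul_comm]
      rw [e3]
      refine ⟨Or.inr, ?_⟩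
      rintro (rfl | h)
      · simpa [zero_lt_iff] using ⟨h0.ne', hx⟩
      · exact h

/-- The set `C` prepares `X` at level `r`: whether `x` lies in `X` depends only on the tuple
`(rv_r (x - c))_{c ∈ C}`. -/
def Prepares (V : ValuationSubring K) (r : V.ValueGroup) (C X : Set K) : Prop :=
  ∀ x x' : K, (∀ c ∈ C, rv V r (x - c) = rv V r (x' - c)) → (x ∈ X ↔ x' ∈ X)

/-- Open and closed valuative balls, with radius in the value group. -/
def IsBall (V : ValuationSubring K) (B : Set K) : Prop :=
  ∃ (a : K) (r : V.ValueGroup), r ≠ 0 ∧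
    (B = {x | V.valuation (x - a) < r} ∨ B = {x | V.valuation (x - a) ≤ r})

/-- Every chain of valuative balls has non-empty intersection. -/
def IsSphericallyComplete (V : ValuationSubring K) : Prop :=
  ∀ 𝓑 : Set (Set K), (∀ B ∈ 𝓑, IsBall V B) → IsChain (· ⊆ ·) 𝓑 → (⋂₀ 𝓑).Nonempty

/-- A valued field of residue characteristic `p` is finitely ramified if only finitely many values
lie between `|p|` and `1`. -/
def IsFinitelyRamified (V : ValuationSubring K) (p : ℕ) : Prop :=
  {γ : V.ValueGroup | V.valuation (p : K) ≤ γ ∧ γ ≤ 1}.Finite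

end ValuedField

section ModelTheory

variable {L : FirstOrder.Language.{u, v}}

/-- The interpretation of the valued field symbols in the `L`-structure on `K` (where `L` expands
the valued field language via `ι`) is given by the field `K` and its valuation ring `V`. -/
structure IsValuedFieldStructure (ι : valLanguage →ᴸ L) {K : Type w} [Field K] [L.Structure K]
    (V : ValuationSubring K) : Prop where
  funMap_add : ∀ x : Fin 2 → K,
    FirstOrder.Language.Structure.funMap (ι.onFunction (n := 2) ringFunc.add) x = x 0 + x 1
  funMap_mul : ∀ x : Fin 2 → K,
    FirstOrder.Language.Structure.funMap (ι.onFunction (n := 2) ringFunc.mul) x = x 0 * x 1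
  funMap_neg : ∀ x : Fin 1 → K,
    FirstOrder.Language.Structure.funMap (ι.onFunction (n := 1) ringFunc.neg) x = -x 0
  funMap_zero : ∀ x : Fin 0 → K,
    FirstOrder.Language.Structure.funMap (ι.onFunction (n := 0) ringFunc.zero) x = 0
  funMap_one : ∀ x : Fin 0 → K,
    FirstOrder.Language.Structure.funMap (ι.onFunction (n := 0) ringFunc.one) x = 1
  relMap_integer : ∀ x : Fin 1 → K,
    FirstOrder.Language.Structure.RelMap (ι.onRelation (n := 1) ValRel.integer) x ↔ x 0 ∈ V

/-- `X ⊆ K` is `(A ∪ RV_r)`-definable, where `RV_r` is regarded as an imaginary sort: `X` is a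
fiber `{x | (x, ξ) ∈ W}`, over a tuple `ξ` of elements of `RV_r`, of an `A`-definable set
`W ⊆ K × RV_r ^ k`, i.e. one whose preimage in `K × K ^ k` is `A`-definable. -/
def DefinableWithRV (L : FirstOrder.Language.{u, v}) {K : Type w} [Field K] [L.Structure K]
    (V : ValuationSubring K) (r : V.ValueGroup) (A X : Set K) : Prop :=
  ∃ (k : ℕ) (W : Set (K × (Fin k → RV V r))) (ξ : Fin k → RV V r),
    A.Definable L {y : Fin (k + 1) → K | (y 0, fun i => rv V r (y i.succ)) ∈ W} ∧
      X = {x | (x, ξ) ∈ W}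

/-- `0`-h-minimality of a theory `T` of valued fields (of equi-characteristic `0`): in every model,
every `(A ∪ RV)`-definable subset is prepared by a finite `A`-definable set. -/
def IsZeroHMinimal (ι : valLanguage →ᴸ L) (T : L.Theory) : Prop :=
  ∀ (N : Type w) [Field N] [L.Structure N] (V : ValuationSubring N),
    IsValuedFieldStructure ι V → N ⊨ T →
      ∀ A X : Set N, DefinableWithRV L V 1 A X →
        ∃ C : Set N, C.Finite ∧ A.Definable₁ L C ∧ Prepares V 1 C X

/-- `0`-h^mix-minimality of a theory `T` of valued fields of characteristic `0`: in every model,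
every `(A ∪ RV_{|n|})`-definable subset, for an integer `n ≥ 1`, is prepared at level `|m|` by a
finite `A`-definable set, for some integer `m ≥ 1`. -/
def IsZeroHMixMinimal (ι : valLanguage →ᴸ L) (T : L.Theory) : Prop :=
  ∀ (N : Type w) [Field N] [L.Structure N] (V : ValuationSubring N),
    IsValuedFieldStructure ι V → N ⊨ T →
      ∀ (A X : Set N) (n : ℕ), 1 ≤ n → DefinableWithRV L V (V.valuation (n : N)) A X →
        ∃ (C : Set N) (m : ℕ), 1 ≤ m ∧ C.Finite ∧ A.Definable₁ L C ∧
          Prepares V (V.valuation (m : N)) C X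

/-- `M` is `κ`-saturated: for every parameter set `A` of cardinality less than `κ`, every set of
formulas over `A` in one variable that is finitely satisfiable in `M` is realized in `M`. -/
def IsSaturated (L : FirstOrder.Language.{u, v}) (κ : Cardinal.{w}) (M : Type w) [L.Structure M] : Prop :=
  ∀ A : Set M, #A < κ → ∀ Φ : Set (L[[A]].Formula (Fin 1)),
    (∀ Φ₀ : Finset (L[[A]].Formula (Fin 1)), (Φ₀ : Set (L[[A]].Formula (Fin 1))) ⊆ Φ →
      ∃ x : Fin 1 → M, ∀ φ ∈ Φ₀, φ.Realize x) →
    ∃ x : Fin 1 → M, ∀ φ ∈ Φ, φ.Realize x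

end ModelTheory

end HenselMin

universe x

/-! The extension is carved out of a large model. Take a saturated `K' ≻ K`, then `N ≻ K'` saturated
beyond the size of `K'`, and let `B ⊆ N` be the image of `K'`. By Zorn (`exists_isRVMaximal`) choose
`M ⊇ B` maximal such that every `M`-definable subset of `N` that is a union of fibres of some
`rv_{|n|}` is already `B`-definable.

The key point is that every `α ∈ N` has a closest point in `M` (`IsRVMaximal.exists_best_approx`).
Averaging shows that finite `M`-definable sets lie in `M` (`IsRVMaximal.subset_of_finite`), so
minimality of the theory provides preparing sets inside `M`. If `α` had no closest point, finite
ramification would give `a ∈ M` closer to `α` than `|m(α - c)|` for all `c` in a given preparing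
set, and the prepared set could not separate `α` from `a`. Saturation of `N` makes this uniform over
families indexed by leading terms, so adjoining `α` to `M` would add no structure on the leading
terms. Maximality then puts `α` in `M`, where it is its own closest point.

The rest follows from closest points. If `a` is closest to `y ∈ X` with `X` definable over `M`, then
`X` contains `a + W` for a `B`-definable `W ∋ y - a` (`IsRVMaximal.exists_definable_translate`).
Since `W` meets `B`, the Tarski-Vaught test gives `M ≺ N`. A small type over `M`, realized by some
`y ∈ N`, becomes a small type over `K'`, so `M` inherits saturation from `K'`. Finally `M` and `B`
have the same values, so a chain of balls of `M` has a common point in `N` by saturation, and the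
closest point of `M` to it lies in every ball. -/

namespace HenselMin

/-! ### Existence of saturated elementary extensions -/

section Saturation

open FirstOrder.Language Filter

/-- Names for the elements of a saturated elementary extension of `K`: elements of `K`, and
realizations of sets of formulas with parameters indexed by `J` among the elements already named. -/
inductive Names (L : FirstOrder.Language.{u, v}) (K : Type w) (J : Type x) : Type (max u v w x)
  | base : K → Names L K J
  | node : (J → Names L K J) → Set (L.Formula (J ⊕ Fin 1)) → Names L K J

variable (L : FirstOrder.Language.{u, v}) (K : Type w) (J : Type x)

/-- Interpretations in `K` of the names, under which each element of `K` is its own name. -/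
def Interp : Type (max u v w x) :=
  {g : Names L K J → K // ∀ k, g (Names.base k) = k}

variable {L K J}

/-- Membership in `S` depends only on the interpretation of the names in `D`. -/
def SupportedOn (D : Set (Names L K J)) (S : Set (Interp L K J)) : Prop :=
  ∀ g g' : Interp L K J, (∀ t ∈ D, g.1 t = g'.1 t) → g ∈ S → g' ∈ S

theorem SupportedOn.mono {D D' : Set (Names L K J)} {S : Set (Interp L K J)}
    (h : SupportedOn D S) (hD : D ⊆ D') : SupportedOn D' S :=
  fun g g' hg => h g g' fun t ht => hg t (hD ht)

theorem SupportedOn.inter {D : Set (Names L K J)} {S S' : Set (Interp L K J)}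
    (h : SupportedOn D S) (h' : SupportedOn D S') : SupportedOn D (S ∩ S') :=
  fun g g' hg hS => ⟨h g g' hg hS.1, h' g g' hg hS.2⟩

theorem nonempty_interp [Nonempty K] : Nonempty (Interp L K J) :=
  let ⟨k⟩ := ‹Nonempty K›
  ⟨⟨fun t => match t with
      | .base k => k
      | .node _ _ => k, fun _ => rfl⟩⟩

open Classical in
/-- Change the interpretation of the single name `node f Φ`. -/
noncomputable def Interp.update (g : Interp L K J) (f : J → Names L K J)
    (Φ : Set (L.Formula (J ⊕ Fin 1))) (x : K) : Interp L K J :=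
  ⟨Function.update g.1 (Names.node f Φ) x, fun k => by
    rw [Function.update_of_ne (by simp)]; exact g.2 k⟩

open Classical in
theorem Interp.update_node (g : Interp L K J) (f : J → Names L K J)
    (Φ : Set (L.Formula (J ⊕ Fin 1))) (x : K) : (g.update f Φ x).1 (Names.node f Φ) = x := by
  rw [Interp.update]
  exact Function.update_self (Names.node f Φ) x g.1

open Classical in
theorem Interp.update_of_ne (g : Interp L K J) (f : J → Names L K J)
    (Φ : Set (L.Formula (J ⊕ Fin 1))) (x : K) {t : Names L K J} (ht : t ≠ Names.node f Φ) :
    (g.update f Φ x).1 t = g.1 t := by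
  rw [Interp.update]
  exact Function.update_of_ne ht x g.1

variable [L.Structure K]

/-- The interpretations for which `Φ` is satisfiable with parameters `f`. -/
def satSet (f : J → Names L K J) (Φ : Set (L.Formula (J ⊕ Fin 1))) : Set (Interp L K J) :=
  {g | ∃ x : K, ∀ φ ∈ Φ, φ.Realize (Sum.elim (fun j => g.1 (f j)) fun _ => x)}

/-- The interpretations for which `t` realizes `Φ` with parameters `f`. -/
def realSet (f : J → Names L K J) (t : Names L K J) (Φ : Set (L.Formula (J ⊕ Fin 1))) :
    Set (Interp L K J) :=
  {g | ∀ φ ∈ Φ, φ.Realize (Sum.elim (fun j => g.1 (f j)) fun _ => g.1 t)}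

/-- Modulo `F`, either `Φ` is not finitely satisfiable with parameters `f`, or the name
`node f Φ` realizes it. -/
def Decides (F : Filter (Interp L K J)) (f : J → Names L K J)
    (Φ : Set (L.Formula (J ⊕ Fin 1))) : Prop :=
  (∃ Φ₀ ⊆ Φ, Φ₀.Finite ∧ (satSet f Φ₀)ᶜ ∈ F) ∨
    ∀ Φ₀ ⊆ Φ, Φ₀.Finite → realSet f (Names.node f Φ) Φ₀ ∈ F

/-- A partial construction of the extension: the names in `D` have been treated, and `F` is the
filter of conditions imposed so far. -/
structure IsStage (D : Set (Names L K J)) (F : Filter (Interp L K J)) : Prop where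
  closed : ∀ f Φ, Names.node f Φ ∈ D → ∀ j, f j ∈ D
  neBot : F.NeBot
  supported : ∀ S ∈ F, ∃ S' ∈ F, S' ⊆ S ∧ SupportedOn D S'
  decides : ∀ f Φ, Names.node f Φ ∈ D → Decides F f Φ

theorem Decides.mono {F F' : Filter (Interp L K J)} (hF : F' ≤ F) {f : J → Names L K J}
    {Φ : Set (L.Formula (J ⊕ Fin 1))} (h : Decides F f Φ) : Decides F' f Φ := by
  rcases h with ⟨Φ₀, h1, h2, h3⟩ | h
  · exact Or.inl ⟨Φ₀, h1, h2, hF h3⟩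
  · exact Or.inr fun Φ₀ h1 h2 => hF (h Φ₀ h1 h2)

theorem SupportedOn.satSet_compl {D : Set (Names L K J)} {f : J → Names L K J}
    (hf : ∀ j, f j ∈ D) (Φ : Set (L.Formula (J ⊕ Fin 1))) : SupportedOn D (satSet f Φ)ᶜ := by
  intro g g' hg h1 h2
  apply h1
  obtain ⟨x, hx⟩ := h2
  refine ⟨x, fun φ hφ => ?_⟩
  simpa only [hg _ (hf _)] using hx φ hφ

theorem SupportedOn.realSet {D : Set (Names L K J)} {f : J → Names L K J} {t : Names L K J}
    (hf : ∀ j, f j ∈ D) (ht : t ∈ D) (Φ : Set (L.Formula (J ⊕ Fin 1))) :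
    SupportedOn D (realSet f t Φ) := by
  intro g g' hg h1 φ hφ
  simpa only [hg _ (hf _), hg _ ht] using h1 φ hφ

theorem realSet_union (f : J → Names L K J) (t : Names L K J)
    (Φ Ψ : Set (L.Formula (J ⊕ Fin 1))) :
    realSet f t (Φ ∪ Ψ) = realSet f t Φ ∩ realSet f t Ψ := by
  ext g
  simp only [realSet, Set.mem_union, Set.mem_inter_iff, Set.mem_ofPred_eq]
  exact ⟨fun h => ⟨fun φ hφ => h φ (Or.inl hφ), fun φ hφ => h φ (Or.inr hφ)⟩,
    fun h φ hφ => hφ.elim (h.1 φ) (h.2 φ)⟩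

theorem IsStage.insert_base {D : Set (Names L K J)} {F : Filter (Interp L K J)}
    (h : IsStage D F) (k : K) : IsStage (insert (Names.base k) D) F where
  closed f Φ hf j := by
    rcases hf with hf | hf
    · cases hf
    · exact Or.inr (h.closed f Φ hf j)
  neBot := h.neBot
  supported S hS := by
    obtain ⟨S', h1, h2, h3⟩ := h.supported S hS
    exact ⟨S', h1, h2, h3.mono (Set.subset_insert _ _)⟩
  decides f Φ hf := by
    rcases hf with hf | hf
    · cases hf
    · exact h.decides f Φ hf

theorem IsStage.insert_node {D : Set (Names L K J)} {F : Filter (Interp L K J)}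
    (h : IsStage D F) {f : J → Names L K J} (hf : ∀ j, f j ∈ D) {F' : Filter (Interp L K J)}
    (hF : F' ≤ F) {Φ : Set (L.Formula (J ⊕ Fin 1))} (hne : F'.NeBot)
    (hd : Decides F' f Φ)
    (hs : ∀ S ∈ F', ∃ S' ∈ F', S' ⊆ S ∧ SupportedOn (insert (Names.node f Φ) D) S') :
    IsStage (insert (Names.node f Φ) D) F' where
  closed f' Φ' hf' j := by
    rcases hf' with hf' | hf'
    · cases hf'
      exact Or.inr (hf j)
    · exact Or.inr (h.closed f' Φ' hf' j)
  neBot := hne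
  supported := hs
  decides f' Φ' hf' := by
    rcases hf' with hf' | hf'
    · cases hf'
      exact hd
    · exact (h.decides f' Φ' hf').mono hF

/-- If some finite part of `Φ` fails to be satisfiable on a set of `F`, its failure can be imposed
without making the filter improper. Otherwise the new name can be made to realize every finite part:
it does not occur in `D`, so changing its value in an interpretation preserves membership in sets
supported on `D`. -/
theorem IsStage.exists_insert_node {D : Set (Names L K J)} {F : Filter (Interp L K J)}
    (h : IsStage D F) {f : J → Names L K J} (hf : ∀ j, f j ∈ D)
    {Φ : Set (L.Formula (J ⊕ Fin 1))} (hD : Names.node f Φ ∉ D) :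
    ∃ F' ≤ F, IsStage (insert (Names.node f Φ) D) F' := by
  have hsub := Set.subset_insert (Names.node f Φ) D
  by_cases hsat : ∃ Φ₀ ⊆ Φ, Φ₀.Finite ∧ satSet f Φ₀ ∉ F
  · obtain ⟨Φ₀, h1, h2, h3⟩ := hsat
    refine ⟨F ⊓ 𝓟 (satSet f Φ₀)ᶜ, inf_le_left, h.insert_node hf inf_le_left ?_
      (Or.inl ⟨Φ₀, h1, h2, mem_inf_of_right (mem_principal_self _)⟩) ?_⟩
    · rw [inf_principal_neBot_iff]
      intro U hU
      by_contra hemp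
      refine h3 (mem_of_superset hU fun g hg => ?_)
      by_contra hg'
      exact hemp ⟨g, hg, hg'⟩
    · intro S hS
      rw [mem_inf_principal] at hS
      obtain ⟨S', h4, h5, h6⟩ := h.supported _ hS
      refine ⟨S' ∩ (satSet f Φ₀)ᶜ, inter_mem_inf h4 (mem_principal_self _),
        fun g hg => h5 hg.1 hg.2, (h6.mono hsub).inter (SupportedOn.satSet_compl
          (fun j => hsub (hf j)) _)⟩
  · push Not at hsat
    let F' : Filter (Interp L K J) :=
      { sets := {S | ∃ S' ∈ F, SupportedOn D S' ∧ ∃ Φ₀ ⊆ Φ, Φ₀.Finite ∧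
          S' ∩ realSet f (Names.node f Φ) Φ₀ ⊆ S}
        univ_sets := ⟨Set.univ, univ_mem, fun _ _ _ _ => trivial, ∅, Set.empty_subset _,
          Set.finite_empty, Set.subset_univ _⟩
        sets_of_superset := by
          rintro S T ⟨S', h1, h2, Φ₀, h3, h4, h5⟩ hST
          exact ⟨S', h1, h2, Φ₀, h3, h4, h5.trans hST⟩
        inter_sets := by
          rintro S T ⟨S', h1, h2, Φ₀, h3, h4, h5⟩ ⟨T', k1, k2, Ψ₀, k3, k4, k5⟩
          refine ⟨S' ∩ T', inter_mem h1 k1, h2.inter k2, Φ₀ ∪ Ψ₀, Set.union_subset h3 k3,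
            h4.union k4, ?_⟩
          rw [realSet_union]
          exact fun g hg => ⟨h5 ⟨hg.1.1, hg.2.1⟩, k5 ⟨hg.1.2, hg.2.2⟩⟩ }
    have hF' : F' ≤ F := by
      intro S hS
      obtain ⟨S', h1, h2, h3⟩ := h.supported S hS
      exact ⟨S', h1, h3, ∅, Set.empty_subset _, Set.finite_empty,
        Set.inter_subset_left.trans h2⟩
    have hreal : ∀ Φ₀ ⊆ Φ, Φ₀.Finite → realSet f (Names.node f Φ) Φ₀ ∈ F' :=
      fun Φ₀ h1 h2 => ⟨Set.univ, univ_mem, fun _ _ _ _ => trivial, Φ₀, h1, h2,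
        Set.inter_subset_right⟩
    refine ⟨F', hF', h.insert_node hf hF' ?_ (Or.inr hreal) ?_⟩
    · refine ⟨fun hbot => ?_⟩
      obtain ⟨S', h1, h2, Φ₀, h3, h4, h5⟩ := empty_mem_iff_bot.2 hbot
      have := h.neBot
      obtain ⟨g, hg, x, hx⟩ := nonempty_of_mem (inter_mem h1 (hsat Φ₀ h3 h4))
      have hup : ∀ t ∈ D, (g.update f Φ x).1 t = g.1 t := fun t ht =>
        g.update_of_ne f Φ x fun e => hD (e ▸ ht)
      refine h5 (a := g.update f Φ x) ⟨h2 g _ (fun t ht => (hup t ht).symm) hg, fun φ hφ => ?_⟩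
      simpa only [g.update_node f Φ x, hup _ (hf _)] using hx φ hφ
    · rintro S ⟨S', h1, h2, Φ₀, h3, h4, h5⟩
      refine ⟨S' ∩ realSet f (Names.node f Φ) Φ₀, inter_mem (hF' h1) (hreal Φ₀ h3 h4), h5,
        (h2.mono hsub).inter (SupportedOn.realSet (fun j => hsub (hf j))
          (Set.mem_insert _ _) _)⟩

/-- Zorn's lemma on pairs `(D, F)`, with filters ordered by refinement. At a maximal pair `D`
contains all names, by induction on names: the arguments of a node are treated before the node. -/
theorem exists_isStage_univ [Nonempty K] : ∃ F : Filter (Interp L K J), IsStage Set.univ F := by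
  let P : Set (Set (Names L K J) × (Filter (Interp L K J))ᵒᵈ) :=
    {p | IsStage p.1 (OrderDual.ofDual p.2)}
  obtain ⟨⟨D, F⟩, hp⟩ : ∃ p, Maximal (· ∈ P) p := by
    apply zorn_le₀
    intro c hc hchain
    have hdir : Directed (· ≥ ·) fun p : c => OrderDual.ofDual p.1.2 := by
      intro p q
      rcases hchain.total p.2 q.2 with h | h
      · exact ⟨q, h.2, le_rfl⟩
      · exact ⟨p, le_rfl, h.2⟩
    refine ⟨(⋃ p : c, p.1.1, OrderDual.toDual (⨅ p : c, OrderDual.ofDual p.1.2)), ?_, ?_⟩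
    -- The empty chain is bounded by `(∅, ⊤)`, and `⊤` is proper because an interpretation exists.
    · rcases isEmpty_or_nonempty c with hce | hce
      · have := nonempty_interp (L := L) (K := K) (J := J)
        rw [iInf_of_empty]
        refine ⟨by simp, (inferInstance : (⊤ : Filter (Interp L K J)).NeBot), ?_, by simp⟩
        intro S hS
        have hS : S = Set.univ := mem_top.1 hS
        exact ⟨S, by simp [hS], le_rfl, fun _ _ _ _ => by rw [hS]; trivial⟩
      · have hle : ∀ p : c, (⨅ p : c, OrderDual.ofDual p.1.2) ≤ OrderDual.ofDual p.1.2 :=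
          fun p => iInf_le _ p
        refine ⟨?_, iInf_neBot_of_directed' hdir fun p => (hc p.2).neBot, ?_, ?_⟩
        · intro f Φ hf j
          obtain ⟨p, hp⟩ := Set.mem_iUnion.1 hf
          exact Set.mem_iUnion.2 ⟨p, (hc p.2).closed f Φ hp j⟩
        · intro S hS
          obtain ⟨p, hp⟩ := (mem_iInf_of_directed hdir S).1 hS
          obtain ⟨S', h1, h2, h3⟩ := (hc p.2).supported S hp
          exact ⟨S', hle p h1, h2, h3.mono fun t ht => Set.mem_iUnion.2 ⟨p, ht⟩⟩
        · intro f Φ hf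
          obtain ⟨p, hp⟩ := Set.mem_iUnion.1 hf
          exact ((hc p.2).decides f Φ hp).mono (hle p)
    · intro p hp
      exact ⟨fun t ht => Set.mem_iUnion.2 ⟨⟨p, hp⟩, ht⟩, 
        iInf_le (fun p : c => OrderDual.ofDual p.1.2) ⟨p, hp⟩⟩
  have hmax : ∀ (t : Names L K J) (F' : Filter (Interp L K J)), F' ≤ OrderDual.ofDual F →
      IsStage (insert t D) F' → t ∈ D := by
    intro t F' hF' hst
    have := hp.le_of_ge (y := (insert t D, OrderDual.toDual F')) hst
      ⟨Set.subset_insert _ _, hF'⟩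
    exact this.1 (Set.mem_insert _ _)
  have hst : IsStage D (OrderDual.ofDual F) := hp.prop
  have hD : ∀ t, t ∈ D := by
    intro t
    induction t with
    | base k => exact hmax _ _ le_rfl (hst.insert_base k)
    | node f Φ ih =>
      by_contra hn
      obtain ⟨F', h1, h2⟩ := hst.exists_insert_node ih hn
      exact hn (hmax _ _ h1 h2)
  exact ⟨OrderDual.ofDual F, by rwa [Set.eq_univ_of_forall hD] at hst⟩

/-- The element of an ultrapower given by a name. -/
def named (U : Ultrafilter (Interp L K J)) (t : Names L K J) :
    (U : Filter (Interp L K J)).Product fun _ => K :=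
  ((fun g => g.1 t : Interp L K J → K) : (U : Filter (Interp L K J)).Product fun _ => K)

variable {U : Ultrafilter (Interp L K J)} [Nonempty K]

/-- By Łoś's theorem, finite satisfiability in the ultrapower rules out the first alternative of
`Decides`, and the second one says that the node is a realization. -/
theorem realize_named_node {F : Filter (Interp L K J)} (hF : IsStage Set.univ F)
    (hU : (U : Filter (Interp L K J)) ≤ F) (f : J → Names L K J)
    (Φ : Set (L.Formula (J ⊕ Fin 1)))
    (h : ∀ Φ₀ ⊆ Φ, Φ₀.Finite → ∃ x : (U : Filter (Interp L K J)).Product fun _ => K,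
      ∀ φ ∈ Φ₀, φ.Realize (Sum.elim (fun j => named U (f j)) fun _ => x)) :
    ∀ φ ∈ Φ, φ.Realize (Sum.elim (fun j => named U (f j)) fun _ => named U (Names.node f Φ)) := by
  have key : ∀ (φ : L.Formula (J ⊕ Fin 1)) (x : Interp L K J → K),
      φ.Realize (Sum.elim (fun j => named U (f j))
        fun _ => (x : (U : Filter (Interp L K J)).Product fun _ => K)) ↔
      ∀ᶠ g : Interp L K J in U, φ.Realize (Sum.elim (fun j => g.1 (f j)) fun _ => x g) := by
    intro φ x
    have := Ultraproduct.realize_formula_cast (u := U) φ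
      (Sum.elim (fun j (g : Interp L K J) => g.1 (f j)) fun _ => x)
    convert! this using 2
    · ext i
      rcases i with i | i <;> rfl
    · ext g
      apply iff_of_eq
      congr 1
      ext i
      rcases i with i | i <;> rfl
  rcases (hF.decides f Φ trivial).mono hU with ⟨Φ₀, h1, h2, h3⟩ | h'
  · exfalso
    obtain ⟨x, hx⟩ := h Φ₀ h1 h2
    induction x using Quotient.inductionOn with | _ x
    have h4 : ∀ᶠ g : Interp L K J in U, ∀ φ ∈ Φ₀,
        φ.Realize (Sum.elim (fun j => g.1 (f j)) fun _ => x g) :=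
      (eventually_all_finite h2).2 fun φ hφ => (key φ x).1 (hx φ hφ)
    obtain ⟨g, h5, h6⟩ := (h4.and h3).exists
    exact h6 ⟨x g, h5⟩
  · intro φ hφ
    refine (key φ _).2 ?_
    filter_upwards [h' {φ} (by simpa using hφ) (Set.finite_singleton φ)] with g hg
    exact hg φ rfl

/-- Parameters indexed by `B` are reindexed by `J`, with an arbitrary base name in the unused
places. -/
theorem exists_named_realize {F : Filter (Interp L K J)} (hF : IsStage Set.univ F)
    (hU : (U : Filter (Interp L K J)) ≤ F) {B : Type*}
    (b : B → (U : Filter (Interp L K J)).Product fun _ => K) (hb : ∀ i, b i ∈ Set.range (named U))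
    (hB : Nonempty (B ↪ J)) (Φ : Set (L.Formula (B ⊕ Fin 1)))
    (h : ∀ Φ₀ ⊆ Φ, Φ₀.Finite → ∃ x : (U : Filter (Interp L K J)).Product fun _ => K,
      ∀ φ ∈ Φ₀, φ.Realize (Sum.elim b fun _ => x)) :
    ∃ t, ∀ φ ∈ Φ, φ.Realize (Sum.elim b fun _ => named U t) := by
  obtain ⟨e⟩ := hB
  choose n hn using hb
  obtain ⟨k⟩ := ‹Nonempty K›
  let f : J → Names L K J := Function.extend e n fun _ => Names.base k
  have hf : (fun i => named U (f (e i))) = b := by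
    ext i
    rw [← hn i]
    exact congrArg _ (e.injective.extend_apply _ _ _)
  have hrel : ∀ (φ : L.Formula (B ⊕ Fin 1)) x,
      (φ.relabel (Sum.map e id)).Realize (Sum.elim (fun j => named U (f j)) x) ↔
        φ.Realize (Sum.elim b x) := by
    intro φ x
    rw [Formula.realize_relabel, Sum.elim_comp_map, Function.comp_id]
    simp only [Function.comp_def, hf]
  refine ⟨Names.node f ((fun φ => φ.relabel (Sum.map e id)) '' Φ), fun φ hφ => ?_⟩
  rw [← hrel]
  refine realize_named_node hF hU f _ (fun Φ₀ h1 h2 => ?_) _ (Set.mem_image_of_mem _ hφ)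
  obtain ⟨Φ₁, h3, h4, rfl⟩ := Set.exists_subset_image_finite_and.1 ⟨Φ₀, h1, h2, rfl⟩
  obtain ⟨x, hx⟩ := h Φ₁ h3 h4
  refine ⟨x, ?_⟩
  rintro _ ⟨φ, hφ, rfl⟩
  exact (hrel _ _).2 (hx φ hφ)

/-- The Tarski-Vaught condition for the named elements: a definable set uses finitely many
parameters, which the infinite `J` can index, and a node realizes its defining formula. -/
theorem meetsDefinable_range_named {F : Filter (Interp L K J)} (hF : IsStage Set.univ F)
    (hU : (U : Filter (Interp L K J)) ≤ F) [Infinite J] :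
    L.MeetsDefinable (Set.range (named U)) := by
  intro D ⟨x, hx⟩ hD
  obtain ⟨A, hA, hAD⟩ := Set.definable_iff_finitely_definable.1 hD
  obtain ⟨φ, hφ⟩ := Set.definable_iff_exists_formula_sum.1 hAD
  have hφ' : ∀ x, φ.Realize (Sum.elim (↑) fun _ => x) ↔ x ∈ D := fun x => by
    have := Set.ext_iff.1 hφ fun _ => x
    exact this.symm
  obtain ⟨t, ht⟩ := exists_named_realize hF hU (fun a : (A : Set _) => a.1) (fun a => hA a.2)
    ⟨(Finite.equivFin A).toEmbedding.trans
      (Fin.valEmbedding.trans (Infinite.natEmbedding J))⟩ {φ}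
    (fun Φ₀ h1 _ => ⟨x, fun ψ hψ => by rw [h1 hψ]; exact (hφ' x).2 hx⟩)
  exact ⟨named U t, (hφ' _).1 (ht φ rfl), t, rfl⟩

theorem realize_iff_constantsVarsEquiv {M : Type*} [L.Structure M] {A : Set M} {α : Type*}
    (φ : L[[A]].Formula α) (x : α → M) :
    φ.Realize x ↔
      Formula.Realize (BoundedFormula.constantsVarsEquiv φ) (Sum.elim ((↑) : A → M) x) :=
  (BoundedFormula.realize_constantsVarsEquiv (φ := φ) (v := x) (xs := default)).symm

/-- The model is the set of named elements of an ultrapower. Since names are closed under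
`J`-indexed nodes and `#J ≥ κ`, every small type over named parameters has a named realization,
without any regularity assumption on `κ`. -/
theorem exists_isSaturated (L : FirstOrder.Language.{u, v}) (K : Type w) [L.Structure K]
    [Nonempty K] (κ : Cardinal.{max u v w}) :
    ∃ (M : Type (max u v w)) (_ : L.Structure M), Nonempty (K ↪ₑ[L] M) ∧ IsSaturated L κ M := by
  obtain ⟨J, hJ⟩ : ∃ J : Type (max u v w), #J = max κ ℵ₀ := ⟨_, Cardinal.mk_out _⟩
  have : Infinite J := Cardinal.infinite_iff.2 (hJ ▸ le_max_right _ _)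
  obtain ⟨F, hF⟩ := exists_isStage_univ (L := L) (K := K) (J := J)
  have := hF.neBot
  let U := Ultrafilter.of F
  have hU : (U : Filter (Interp L K J)) ≤ F := Ultrafilter.of_le F
  have hmeet := meetsDefinable_range_named hF hU
  let S := hmeet.toElementarySubstructure
  have hS : ∀ x, x ∈ S ↔ x ∈ Set.range (named U) := fun x => by
    rw [← hmeet.closure_eq_self]
    rfl
  refine ⟨S, inferInstance, ⟨⟨fun k => ⟨named U (Names.base k), (hS _).2 ⟨_, rfl⟩⟩, ?_⟩⟩, ?_⟩
  · intro n φ x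
    rw [← S.subtype.map_formula]
    refine (Ultraproduct.realize_formula_cast (u := U) φ
      (fun i (g : Interp L K J) => g.1 (Names.base (x i)))).trans ?_
    have : ∀ g : Interp L K J, (fun i => g.1 (Names.base (x i))) = x := fun g =>
      funext fun i => g.2 _
    simp only [this, eventually_const]
  · intro A hA Φ hΦ
    have hfin : ∀ Φ₀ ⊆ (fun φ : L[[A]].Formula (Fin 1) =>
        BoundedFormula.constantsVarsEquiv φ) '' Φ, Φ₀.Finite →
        ∃ x : (U : Filter (Interp L K J)).Product fun _ => K, ∀ φ ∈ Φ₀,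
          Formula.Realize φ (Sum.elim (fun a : A => S.subtype a.1) fun _ => x) := by
      intro Φ₀ h1 h2
      obtain ⟨Φ₁, h3, h4, rfl⟩ := Set.exists_subset_image_finite_and.1 ⟨Φ₀, h1, h2, rfl⟩
      obtain ⟨x, hx⟩ := hΦ h4.toFinset (by simpa using h3)
      refine ⟨(x 0).1, ?_⟩
      rintro _ ⟨φ, hφ, rfl⟩
      have := hx φ (by simpa using hφ)
      rw [realize_iff_constantsVarsEquiv, ← S.subtype.map_formula] at this
      convert! this using 1
      ext i
      rcases i with i | i
      · rfl
      · rw [Subsingleton.elim i 0]; rfl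
    obtain ⟨t, ht⟩ := exists_named_realize hF hU (B := A) (fun a => S.subtype a.1)
      (fun a => (hS _).1 a.1.2)
      (Cardinal.le_def _ _ |>.1 (hA.le.trans ((le_max_left _ _).trans hJ.ge)))
      ((fun φ : L[[A]].Formula (Fin 1) => BoundedFormula.constantsVarsEquiv φ) '' Φ) hfin
    refine ⟨fun _ => ⟨named U t, (hS _).2 ⟨t, rfl⟩⟩, fun φ hφ => ?_⟩
    rw [realize_iff_constantsVarsEquiv, ← S.subtype.map_formula]
    convert! ht _ (Set.mem_image_of_mem _ hφ) using 1
    ext i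
    rcases i with i | i <;> rfl

end Saturation

/-! ### Transfer of the valued field structure along elementary equivalence -/

section Transfer

open FirstOrder.Language FirstOrder.Language.Structure

variable {L : FirstOrder.Language.{u, v}} (ι : valLanguage →ᴸ L)

/-- The language of rings inside an expansion of the valued field language. -/
def ringHom : Language.ring →ᴸ L where
  onFunction _ f := ι.onFunction f
  onRelation _ r := nomatch r

/-- Axioms for valuation rings. -/
def valuationAxioms : L.Theory :=
  let add : L.Functions 2 := ι.onFunction ringFunc.add
  let mul : L.Functions 2 := ι.onFunction ringFunc.mul
  let neg : L.Functions 1 := ι.onFunction ringFunc.neg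
  let zero : L.Functions 0 := ι.onFunction ringFunc.zero
  let one : L.Functions 0 := ι.onFunction ringFunc.one
  let O : L.Relations 1 := ι.onRelation ValRel.integer
  { O.boundedFormula₁ (Constants.term zero),
    O.boundedFormula₁ (Constants.term one),
    ∀' (O.boundedFormula₁ (&0) ⟹ O.boundedFormula₁ (neg.apply₁ (&0))),
    ∀' ∀' (O.boundedFormula₁ (&0) ⟹ O.boundedFormula₁ (&1) ⟹
      O.boundedFormula₁ (add.apply₂ (&0) (&1))),
    ∀' ∀' (O.boundedFormula₁ (&0) ⟹ O.boundedFormula₁ (&1) ⟹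
      O.boundedFormula₁ (mul.apply₂ (&0) (&1))),
    ∀' ∀' (((mul.apply₂ (&0) (&1)) =' (Constants.term one)) ⟹
      ∼(O.boundedFormula₁ (&0)) ⟹ O.boundedFormula₁ (&1)) }

variable {ι}

/-- An `L`-structure whose ring symbols are interpreted by the field operations. -/
structure IsFieldStructure (ι : valLanguage →ᴸ L) (K : Type w) [Field K] [L.Structure K] :
    Prop where
  funMap_add : ∀ x : Fin 2 → K, funMap (ι.onFunction (n := 2) ringFunc.add) x = x 0 + x 1
  funMap_mul : ∀ x : Fin 2 → K, funMap (ι.onFunction (n := 2) ringFunc.mul) x = x 0 * x 1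
  funMap_neg : ∀ x : Fin 1 → K, funMap (ι.onFunction (n := 1) ringFunc.neg) x = -x 0
  funMap_zero : ∀ x : Fin 0 → K, funMap (ι.onFunction (n := 0) ringFunc.zero) x = 0
  funMap_one : ∀ x : Fin 0 → K, funMap (ι.onFunction (n := 0) ringFunc.one) x = 1

theorem IsValuedFieldStructure.isFieldStructure {K : Type w} [Field K] [L.Structure K]
    {V : ValuationSubring K} (h : IsValuedFieldStructure ι V) : IsFieldStructure ι K where
  funMap_add := h.funMap_add
  funMap_mul := h.funMap_mul
  funMap_neg := h.funMap_neg
  funMap_zero := h.funMap_zero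
  funMap_one := h.funMap_one

theorem IsFieldStructure.model_valuationAxioms_iff {K : Type w} [Field K] [L.Structure K]
    (h : IsFieldStructure ι K) :
    K ⊨ valuationAxioms ι ↔ ∃ V : ValuationSubring K, IsValuedFieldStructure ι V := by
  let O : Set K := {x | RelMap (ι.onRelation (n := 1) ValRel.integer) ![x]}
  have hrel : ∀ x : Fin 1 → K, RelMap (ι.onRelation (n := 1) ValRel.integer) x ↔ x 0 ∈ O := by
    intro x
    rw [show x = ![x 0] from funext fun i => by rw [Subsingleton.elim i 0]; rfl]
    rfl
  have key : K ⊨ valuationAxioms ι ↔ 0 ∈ O ∧ 1 ∈ O ∧ (∀ x ∈ O, -x ∈ O) ∧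
      (∀ x y, x ∈ O → y ∈ O → x + y ∈ O) ∧ (∀ x y, x ∈ O → y ∈ O → x * y ∈ O) ∧
      ∀ x y, x * y = 1 → x ∉ O → y ∈ O := by
    simp [valuationAxioms, Theory.model_insert_iff, Sentence.Realize, Formula.Realize, hrel,
      h.funMap_add, h.funMap_mul, h.funMap_neg, h.funMap_zero, h.funMap_one, Fin.snoc,
      constantMap]
  rw [key]
  constructor
  · rintro ⟨h0, h1, hn, ha, hm, hi⟩
    refine ⟨{ carrier := O, mul_mem' := hm _ _, one_mem' := h1, add_mem' := ha _ _,
              zero_mem' := h0, neg_mem' := hn _, mem_or_inv_mem' := fun x => ?_ }, ?_⟩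
    · by_cases hx : x = 0
      · exact Or.inl (hx ▸ h0)
      · exact or_iff_not_imp_left.2 (hi x x⁻¹ (mul_inv_cancel₀ hx))
    · exact ⟨h.funMap_add, h.funMap_mul, h.funMap_neg, h.funMap_zero, h.funMap_one, hrel⟩
  · rintro ⟨V, hV⟩
    have hO : ∀ x, x ∈ O ↔ x ∈ V := fun x => hV.relMap_integer ![x]
    simp only [hO]
    refine ⟨zero_mem V, one_mem V, fun x => neg_mem, fun x y => add_mem, fun x y => mul_mem,
      fun x y hxy hx => ?_⟩
    rw [eq_inv_of_mul_eq_one_right hxy]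
    exact (V.mem_or_inv_mem x).resolve_left hx

/-- The field axioms are sentences of the ring reduct, so they pass to `N`. -/
theorem IsFieldStructure.of_elementarilyEquivalent {K : Type w} [Field K] [L.Structure K]
    (h : IsFieldStructure ι K) {N : Type x} [L.Structure N] (hN : K ≅[L] N) :
    ∃ _ : Field N, IsFieldStructure ι N := by
  let _ : Language.ring.Structure K := (ringHom ι).reduct K
  let _ : Language.ring.Structure N := (ringHom ι).reduct N
  let _ : Ring.CompatibleRing K :=
    { funMap_add := h.funMap_add
      funMap_mul := h.funMap_mul
      funMap_neg := h.funMap_neg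
      funMap_zero := h.funMap_zero
      funMap_one := h.funMap_one }
  have hK : K ⊨ Theory.field := inferInstance
  have hNf : N ⊨ Theory.field := by
    refine ⟨fun φ hφ => ?_⟩
    have h1 : K ⊨ φ := hK.realize_of_mem φ hφ
    exact (LHom.realize_onSentence N (φ := ringHom ι) φ).1
      ((hN.realize_sentence _).1 ((LHom.realize_onSentence K (φ := ringHom ι) φ).2 h1))
  let _ := Field.fieldOfModelField N
  let _ := Field.compatibleRingOfModelField N
  exact ⟨inferInstance, Ring.CompatibleRing.funMap_add, Ring.CompatibleRing.funMap_mul,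
    Ring.CompatibleRing.funMap_neg, Ring.CompatibleRing.funMap_zero,
    Ring.CompatibleRing.funMap_one⟩

theorem IsValuedFieldStructure.exists_of_elementarilyEquivalent {K : Type w} [Field K]
    [L.Structure K] {V : ValuationSubring K} (h : IsValuedFieldStructure ι V) {N : Type x}
    [L.Structure N] (hN : K ≅[L] N) :
    ∃ (_ : Field N) (W : ValuationSubring N), IsValuedFieldStructure ι W := by
  obtain ⟨F, hF⟩ := h.isFieldStructure.of_elementarilyEquivalent hN
  refine ⟨F, hF.model_valuationAxioms_iff.1 ?_⟩
  exact hN.theory_model_iff.1 (h.isFieldStructure.model_valuationAxioms_iff.2 ⟨V, h⟩)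

variable {K : Type w} [Field K] [L.Structure K] {V : ValuationSubring K}
  {N : Type x} [Field N] [L.Structure N] {W : ValuationSubring N}

/-- Elementary embeddings of valued field structures are ring homomorphisms. -/
def toRingHom (h : IsValuedFieldStructure ι V) (hW : IsValuedFieldStructure ι W)
    (j : K ↪ₑ[L] N) : K →+* N where
  toFun := j
  map_one' := by
    rw [← h.funMap_one ![], j.map_fun, hW.funMap_one]
  map_zero' := by
    rw [← h.funMap_zero ![], j.map_fun, hW.funMap_zero]
  map_add' x y := by
    have := j.map_fun (ι.onFunction (n := 2) ringFunc.add) ![x, y]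
    rwa [h.funMap_add, hW.funMap_add] at this
  map_mul' x y := by
    have := j.map_fun (ι.onFunction (n := 2) ringFunc.mul) ![x, y]
    rwa [h.funMap_mul, hW.funMap_mul] at this

theorem toRingHom_apply (h : IsValuedFieldStructure ι V) (hW : IsValuedFieldStructure ι W)
    (j : K ↪ₑ[L] N) (x : K) : toRingHom h hW j x = j x := rfl

theorem mem_valuationSubring_iff (h : IsValuedFieldStructure ι V) (hW : IsValuedFieldStructure ι W)
    (j : K ↪ₑ[L] N) (x : K) : j x ∈ W ↔ x ∈ V := by
  have := j.map_rel (ι.onRelation (n := 1) ValRel.integer) ![x]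
  rwa [h.relMap_integer, hW.relMap_integer] at this

/-- Comparing values amounts to integrality of the quotient, which an elementary embedding preserves
and reflects. -/
theorem valuation_map_le_iff (h : IsValuedFieldStructure ι V) (hW : IsValuedFieldStructure ι W)
    (j : K ↪ₑ[L] N) (x y : K) :
    W.valuation (j x) ≤ W.valuation (j y) ↔ V.valuation x ≤ V.valuation y := by
  rw [← toRingHom_apply h hW, ← toRingHom_apply h hW]
  by_cases hy : y = 0
  · subst hy
    rw [map_zero, map_zero, map_zero, le_zero_iff, le_zero_iff, map_eq_zero, map_eq_zero,
      map_eq_zero]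
  · have h1 : 0 < W.valuation (toRingHom h hW j y) := by simpa [zero_lt_iff] using hy
    have h2 : 0 < V.valuation y := by simpa [zero_lt_iff] using hy
    rw [← div_le_one₀ h1, ← div_le_one₀ h2, ← map_div₀, ← map_div₀, ← map_div₀,
      W.valuation_le_one_iff, V.valuation_le_one_iff, toRingHom_apply,
      mem_valuationSubring_iff h hW j]

end Transfer

/-! ### Definable sets along an elementary embedding -/

section Elementary

open FirstOrder.Language

variable {L : FirstOrder.Language.{u, v}} {M : Type w} {N : Type x} [L.Structure M] [L.Structure N]
  (j : M ↪ₑ[L] N)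

/-- A set definable over the image of `A` under an elementary embedding is given by a formula with
parameters in `A`. -/
theorem exists_formula_of_definable {A : Set M} {X : Set N} (hX : (j '' A).Definable₁ L X) :
    ∃ φ : L.Formula (A ⊕ Fin 1), (∀ y, y ∈ X ↔ φ.Realize (Sum.elim (fun a : A => j a) fun _ => y)) ∧
      ∀ x, j x ∈ X ↔ φ.Realize (Sum.elim ((↑) : A → M) fun _ => x) := by
  obtain ⟨φ, hφ⟩ := Set.definable_iff_exists_formula_sum.1 hX
  choose e he he' using fun a : j '' A => a.2
  let e' : (j '' A : Set N) → A := fun a => ⟨e a, he a⟩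
  have h1 : ∀ y, y ∈ X ↔
      (φ.relabel (Sum.map e' id)).Realize (Sum.elim (fun a : A => j a) fun _ => y) := by
    intro y
    have := Set.ext_iff.1 hφ fun _ => y
    refine this.trans ?_
    rw [Formula.realize_relabel, Sum.elim_comp_map, Function.comp_id]
    have h2 : (fun a : A => j a) ∘ e' = (↑) := funext he'
    rw [h2]
    rfl
  refine ⟨_, h1, fun x => (h1 _).trans ?_⟩
  rw [← j.map_formula, Sum.comp_elim]
  rfl

theorem meetsDefinable_range : L.MeetsDefinable (Set.range j) := by
  rintro X ⟨y, hy⟩ hX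
  rw [← Set.image_univ] at hX
  obtain ⟨φ, h1, h2⟩ := exists_formula_of_definable j hX
  have h3 := j.map_formula (φ.iExs (Fin 1)) (fun a : (Set.univ : Set M) => a.1)
  simp only [Formula.realize_iExs] at h3
  obtain ⟨x, hx⟩ := h3.1 ⟨fun _ => y, (h1 y).1 hy⟩
  refine ⟨j (x 0), (h2 _).2 ?_, x 0, rfl⟩
  rwa [show (fun _ => x 0) = x from funext fun i => congrArg x (Subsingleton.elim 0 i)]

/-- The common points of finite subfamilies are only given in `N`, but a finite intersection is
definable over the image of `M`, hence meets that image; saturation of `M` then applies. -/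
theorem IsSaturated.exists_forall_mem {κ : Cardinal.{w}} (hM : IsSaturated L κ M) {A : Set M}
    (hA : #A < κ) {𝒳 : Set (Set N)} (h𝒳 : ∀ X ∈ 𝒳, (j '' A).Definable₁ L X)
    (hfip : ∀ 𝒴 ⊆ 𝒳, 𝒴.Finite → (⋂₀ 𝒴).Nonempty) : ∃ x : M, ∀ X ∈ 𝒳, j x ∈ X := by
  have hform : ∀ X ∈ 𝒳, ∃ φ : L[[A]].Formula (Fin 1), ∀ x, j (x 0) ∈ X ↔ φ.Realize x := by
    intro X hX
    obtain ⟨φ, -, h2⟩ := exists_formula_of_definable j (h𝒳 X hX)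
    refine ⟨BoundedFormula.constantsVarsEquiv.symm φ, fun x => ?_⟩
    rw [realize_iff_constantsVarsEquiv, Equiv.apply_symm_apply, h2,
      show (fun _ => x 0) = x from funext fun i => congrArg x (Subsingleton.elim 0 i)]
  choose! φ hφ using hform
  obtain ⟨x, hx⟩ := hM A hA (φ '' 𝒳) fun Φ₀ hΦ₀ => by
    obtain ⟨𝒴, h1, h2, h3⟩ := Set.exists_subset_image_finite_and.1
      ⟨(Φ₀ : Set (L[[A]].Formula (Fin 1))), hΦ₀, Φ₀.finite_toSet, rfl⟩
    have hdef : (Set.range j).Definable₁ L (⋂₀ 𝒴) := by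
      have h4 := Set.definable_biInter_finset (L := L) (A := Set.range j)
        (f := fun X : 𝒴 => {x : Fin 1 → N | x 0 ∈ X.1})
        (fun X => (h𝒳 X.1 (h1 X.2)).mono (Set.image_subset_range _ _))
        (@Finset.univ _ h2.fintype)
      rw [Set.Definable₁]
      convert h4 using 1
      ext x
      simp
    obtain ⟨_, h5, x, rfl⟩ := meetsDefinable_range j _ (hfip 𝒴 h1 h2) hdef
    refine ⟨fun _ => x, fun ψ hψ => ?_⟩
    have hψ : ψ ∈ φ '' 𝒴 := h3.subset hψ
    obtain ⟨X, hX, rfl⟩ := hψ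
    exact (hφ X (h1 hX) _).1 (h5 X hX)
  exact ⟨x 0, fun X hX => (hφ X hX _).2 (hx _ (Set.mem_image_of_mem _ hX))⟩

end Elementary

/-! ### Closure properties of definable sets and functions -/

section DefinableCalculus

open FirstOrder.Language Set

variable {L : FirstOrder.Language.{u, v}} {N : Type w} [L.Structure N] {A : Set N} {α : Type*}

theorem definable_setOf_exists {P : (α → N) → N → Prop}
    (h : A.Definable L {w : α ⊕ Fin 1 → N | P (w ∘ Sum.inl) (w (Sum.inr 0))}) :
    A.Definable L {x : α → N | ∃ z, P x z} := by
  convert h.exists_of_finite using 1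
  ext x
  simp only [mem_ofPred_eq, Sum.elim_comp_inl, Sum.elim_inr]
  exact ⟨fun ⟨z, hz⟩ => ⟨fun _ => z, hz⟩, fun ⟨z, hz⟩ => ⟨z 0, hz⟩⟩

theorem definable_setOf_forall {P : (α → N) → N → Prop}
    (h : A.Definable L {w : α ⊕ Fin 1 → N | P (w ∘ Sum.inl) (w (Sum.inr 0))}) :
    A.Definable L {x : α → N | ∀ z, P x z} := by
  convert h.forall_of_finite using 1
  ext x
  simp only [mem_ofPred_eq, Sum.elim_comp_inl, Sum.elim_inr]
  exact ⟨fun h z => h _, fun h z => h fun _ => z⟩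

theorem definable_setOf_imp {P R : (α → N) → Prop} (hP : A.Definable L {x | P x})
    (hR : A.Definable L {x | R x}) : A.Definable L {x | P x → R x} := by
  convert hP.compl.union hR using 1
  ext x
  simp [imp_iff_not_or]

theorem definable_setOf_and {P R : (α → N) → Prop} (hP : A.Definable L {x | P x})
    (hR : A.Definable L {x | R x}) : A.Definable L {x | P x ∧ R x} :=
  hP.inter hR

theorem definable_setOf_forall_finite {β : Type*} [Finite β] {P : β → (α → N) → Prop}
    (hP : ∀ i, A.Definable L {x | P i x}) : A.Definable L {x | ∀ i, P i x} := by
  rw [ofPred_forall]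
  exact definable_iInter_of_finite hP

theorem Definable₁.setOf_mem {X : Set N} (hX : A.Definable₁ L X) {f : (α → N) → N}
    (hf : A.DefinableFun L f) : A.Definable L {x | f x ∈ X} :=
  Set.Definable.preimage_map (F := fun x (_ : Fin 1) => f x) (fun _ => hf) hX

theorem setOf_mem_of_definable {E : Set (Fin 2 → N)} (hE : A.Definable L E) {f g : (α → N) → N}
    (hf : A.DefinableFun L f) (hg : A.DefinableFun L g) : A.Definable L {x | ![f x, g x] ∈ E} :=
  hE.preimage_map (F := fun x => ![f x, g x]) fun i => by
    fin_cases i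
    · exact hf
    · exact hg

theorem definableFun_comp₁ {f : (Fin 1 → N) → N} (hf : A.DefinableFun L f) {g : (α → N) → N}
    (hg : A.DefinableFun L g) : A.DefinableFun L fun x => f fun _ => g x :=
  DefinableFun.comp (g := fun x _ => g x) (fun _ => hg) hf

theorem definableFun_comp₂ {f : (Fin 2 → N) → N} (hf : A.DefinableFun L f) {g h : (α → N) → N}
    (hg : A.DefinableFun L g) (hh : A.DefinableFun L h) :
    A.DefinableFun L fun x => f ![g x, h x] :=
  DefinableFun.comp (g := fun x => ![g x, h x]) (fun i => by
    fin_cases i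
    · exact hg
    · exact hh) hf

theorem _root_.Set.DefinableFun.comp_left {f : (α → N) → N} (hf : A.DefinableFun L f)
    {β : Type*} (r : α → β) : A.DefinableFun L fun w : β → N => f (w ∘ r) := by
  simpa only [DefinableFun, Function.tupleGraph, Option.elim] using!
    Set.Definable.preimage_comp (fun i : Option α => i.map r) hf

variable [Field N] {V : ValuationSubring N} {ι : valLanguage →ᴸ L}

namespace IsValuedFieldStructure

theorem definableFun_add (hV : IsValuedFieldStructure ι V) {f g : (α → N) → N}
    (hf : A.DefinableFun L f) (hg : A.DefinableFun L g) :
    A.DefinableFun L fun x => f x + g x := by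
  simpa only [hV.funMap_add] using! definableFun_comp₂ (DefinableFun.of_empty
    (DefinableFun.fun_symbol (ι.onFunction (n := 2) ringFunc.add))) hf hg

theorem definableFun_mul (hV : IsValuedFieldStructure ι V) {f g : (α → N) → N}
    (hf : A.DefinableFun L f) (hg : A.DefinableFun L g) :
    A.DefinableFun L fun x => f x * g x := by
  simpa only [hV.funMap_mul] using! definableFun_comp₂ (DefinableFun.of_empty
    (DefinableFun.fun_symbol (ι.onFunction (n := 2) ringFunc.mul))) hf hg

theorem definableFun_neg (hV : IsValuedFieldStructure ι V) {f : (α → N) → N}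
    (hf : A.DefinableFun L f) : A.DefinableFun L fun x => -f x := by
  simpa only [hV.funMap_neg] using! definableFun_comp₁ (DefinableFun.of_empty
    (DefinableFun.fun_symbol (ι.onFunction (n := 1) ringFunc.neg))) hf

theorem definableFun_sub (hV : IsValuedFieldStructure ι V) {f g : (α → N) → N}
    (hf : A.DefinableFun L f) (hg : A.DefinableFun L g) :
    A.DefinableFun L fun x => f x - g x := by
  simpa only [sub_eq_add_neg] using hV.definableFun_add hf (hV.definableFun_neg hg)

theorem definableFun_natCast (hV : IsValuedFieldStructure ι V) (n : ℕ) :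
    A.DefinableFun L fun _ : α → N => (n : N) := by
  induction n with
  | zero =>
    have := (Term.func (ι.onFunction (n := 0) ringFunc.zero) ![] : L.Term α).definableFun_realize
      (M := N)
    convert! this.of_empty (A := A) using 2
    exact Nat.cast_zero.trans (hV.funMap_zero _).symm
  | succ n ih =>
    have h1 : A.DefinableFun L fun _ : α → N => (1 : N) := by
      have := (Term.func (ι.onFunction (n := 0) ringFunc.one) ![] : L.Term α).definableFun_realize
        (M := N)
      convert! this.of_empty (A := A) using 2
      exact (hV.funMap_one _).symm
    simpa only [Nat.cast_succ] using hV.definableFun_add ih h1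

theorem definable_mem (hV : IsValuedFieldStructure ι V) {f : (α → N) → N}
    (hf : A.DefinableFun L f) : A.Definable L {x | f x ∈ V} := by
  refine Definable₁.setOf_mem (X := V) ?_ hf
  have : (∅ : Set N).Definable L {x : Fin 1 → N | x 0 ∈ V} :=
    Set.empty_definable_iff.2 ⟨Relations.formula₁ (ι.onRelation (n := 1) ValRel.integer)
      (Term.var 0), by
        ext x
        simp [hV.relMap_integer]⟩
  exact this.mono (Set.empty_subset _)

theorem definable_le (hV : IsValuedFieldStructure ι V) {f g : (α → N) → N}
    (hf : A.DefinableFun L f) (hg : A.DefinableFun L g) :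
    A.Definable L {x | V.valuation (f x) ≤ V.valuation (g x)} := by
  have h : ∀ x y : N, V.valuation x ≤ V.valuation y ↔ ∃ z, z ∈ V ∧ z * y = x := fun x y => by
    rw [V.valuation_le_iff]
    exact ⟨fun ⟨z, hz⟩ => ⟨z.1, z.2, hz⟩, fun ⟨z, h1, h2⟩ => ⟨⟨z, h1⟩, h2⟩⟩
  simp only [h]
  apply definable_setOf_exists
  exact (hV.definable_mem (DefinableFun.proj L)).inter ((hV.definableFun_mul
    (DefinableFun.proj L) (hg.comp_left Sum.inl)).ofPred_eq (hf.comp_left Sum.inl))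

theorem definable_lt (hV : IsValuedFieldStructure ι V) {f g : (α → N) → N}
    (hf : A.DefinableFun L f) (hg : A.DefinableFun L g) :
    A.Definable L {x | V.valuation (f x) < V.valuation (g x)} := by
  convert (hV.definable_le hg hf).compl using 1
  ext x
  simp

end IsValuedFieldStructure

end DefinableCalculus

/-! ### Leading terms at level `|n|` -/

section LeadingTerms

variable {N : Type w} [Field N] {V : ValuationSubring N}

/-- Equality of leading terms at level `|n|`. -/
def RVEq (V : ValuationSubring N) (n : ℕ) (x y : N) : Prop :=
  rv V (V.valuation (n : N)) x = rv V (V.valuation (n : N)) y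

theorem valuation_natCast_le_one (V : ValuationSubring N) (n : ℕ) : V.valuation (n : N) ≤ 1 :=
  (V.valuation_le_one_iff _).2 (natCast_mem V n)

variable [CharZero N] {n : ℕ} {x y z : N}

theorem valuation_natCast_pos (V : ValuationSubring N) (hn : 1 ≤ n) :
    0 < V.valuation (n : N) := by
  rw [zero_lt_iff, V.valuation.ne_zero_iff]
  exact_mod_cast (Nat.one_le_iff_ne_zero.1 hn)

theorem rvEq_iff (hn : 1 ≤ n) :
    RVEq V n x y ↔ x = y ∨ V.valuation (x - y) < V.valuation (n * x) := by
  rw [map_mul]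
  exact rv_eq_rv_iff V (valuation_natCast_pos V hn) (valuation_natCast_le_one V n) x y

theorem RVEq.valuation_eq (hn : 1 ≤ n) (h : RVEq V n x y) : V.valuation x = V.valuation y := by
  rcases (rvEq_iff hn).1 h with rfl | h
  · rfl
  · refine (V.valuation.map_eq_of_sub_lt ?_).symm
    rw [Valuation.map_sub_swap]
    refine h.trans_le ?_
    rw [map_mul]
    exact mul_le_of_le_one_left' (valuation_natCast_le_one V n)

theorem rvEq_of_le_of_lt (hn : 1 ≤ n) {r : V.ValueGroup} (h : V.valuation (x - y) ≤ r)
    (hr : r < V.valuation (n * x)) : RVEq V n x y :=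
  (rvEq_iff hn).2 (Or.inr (h.trans_lt hr))

end LeadingTerms

/-! ### Definability of fibres, means and leading term equivalence -/

section Definability

open FirstOrder.Language Set

variable {L : FirstOrder.Language.{u, v}} {N : Type w} [L.Structure N] {A : Set N} {α : Type*}

/-- The parameter `a`, when not already in `M`, is turned into the first variable. -/
theorem exists_fibre_of_insert {M W : Set N} {a : N} (h : (insert a M).Definable₁ L W) :
    ∃ E : Set (Fin 2 → N), M.Definable L E ∧ ∀ y, y ∈ W ↔ ![a, y] ∈ E := by
  classical
  obtain ⟨φ, hφ⟩ := definable_iff_exists_formula_sum.1 h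
  let r : (insert a M : Set N) ⊕ Fin 1 → M ⊕ Fin 2 :=
    Sum.elim (fun c => if hc : c.1 ∈ M then Sum.inl ⟨c, hc⟩ else Sum.inr 0) fun _ => Sum.inr 1
  refine ⟨_, definable_iff_exists_formula_sum.2 ⟨φ.relabel r, rfl⟩, fun y => ?_⟩
  refine (Set.ext_iff.1 hφ fun _ => y).trans ?_
  simp only [mem_ofPred_eq, Formula.realize_relabel]
  apply iff_of_eq
  congr 1
  ext i
  rcases i with ⟨c, hc⟩ | i
  · by_cases hcM : c ∈ M
    · simp [r, hcM]
    · have : c = a := hc.resolve_right hcM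
      subst this
      simp [r, hcM]
  · simp [r]

variable [Field N] {V : ValuationSubring N} {ι : valLanguage →ᴸ L} {n : ℕ}

theorem definableWithRV_of_definable₁ {X : Set N} (hX : A.Definable₁ L X) (r : V.ValueGroup) :
    DefinableWithRV L V r A X :=
  ⟨0, {x | x.1 ∈ X}, Fin.elim0, hX, rfl⟩

/-- By invariance in the second coordinate, `E` is the full preimage of its image in `N × RV`, so
the fibre depends on `y` only through its leading term. -/
theorem definableWithRV_fibre {E : Set (Fin 2 → N)} (hE : A.Definable L E)
    (hinv : ∀ x y y', RVEq V n y y' → ![x, y] ∈ E → ![x, y'] ∈ E) (y : N) :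
    DefinableWithRV L V (V.valuation (n : N)) A {x | ![x, y] ∈ E} := by
  refine ⟨1, {p | ∃ z, rv V (V.valuation (n : N)) z = p.2 0 ∧ ![p.1, z] ∈ E}, fun _ => rv V _ y,
    ?_, ?_⟩
  · convert hE using 1
    ext x
    have hx : x = ![x 0, x 1] := by
      ext i
      fin_cases i <;> rfl
    simp only [mem_ofPred_eq]
    constructor
    · rintro ⟨z, hz, hzE⟩
      rw [hx]
      exact hinv _ _ _ hz hzE
    · intro h
      exact ⟨x 1, rfl, by rwa [← hx]⟩
  · ext x
    exact ⟨fun h => ⟨y, rfl, h⟩, fun ⟨z, hz, h⟩ => hinv _ _ _ hz h⟩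

theorem IsValuedFieldStructure.definableFun_sum (hV : IsValuedFieldStructure ι V) {β : Type*}
    (s : Finset β) {f : β → (α → N) → N} (hf : ∀ i, A.DefinableFun L (f i)) :
    A.DefinableFun L fun x => ∑ i ∈ s, f i x := by
  classical
  induction s using Finset.induction_on with
  | empty => simpa using hV.definableFun_natCast (A := A) (α := α) 0
  | insert i s hi ih =>
    simp only [Finset.sum_insert hi]
    exact hV.definableFun_add (hf i) ih

/-- The formula quantifies over injective enumerations of `C`; the sum does not depend on the
enumeration. -/
theorem IsValuedFieldStructure.definable_mean (hV : IsValuedFieldStructure ι V) {C : Set N}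
    (hC : C.Finite) (hdef : A.Definable₁ L C) (hn : (C.ncard : N) ≠ 0) :
    A.Definable₁ L {(∑ c ∈ hC.toFinset, c) / (C.ncard : N)} := by
  have h : A.Definable L {w : Fin 1 ⊕ Fin C.ncard → N |
      (∀ i, w (Sum.inr i) ∈ C) ∧ (∀ i k, w (Sum.inr i) = w (Sum.inr k) → i = k) ∧
        w (Sum.inl 0) * (C.ncard : N) = ∑ i, w (Sum.inr i)} := by
    refine definable_setOf_and (definable_setOf_forall_finite fun i =>
      Definable₁.setOf_mem hdef (DefinableFun.proj L)) (definable_setOf_and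
        (definable_setOf_forall_finite fun i => definable_setOf_forall_finite fun k => ?_) ?_)
    · by_cases hik : i = k
      · simp [hik]
      · simp only [hik, imp_false]
        exact ((DefinableFun.proj L).ofPred_eq (DefinableFun.proj L)).compl
    · exact (hV.definableFun_mul (DefinableFun.proj L) (hV.definableFun_natCast _)).ofPred_eq
        (hV.definableFun_sum _ fun i => DefinableFun.proj L)
  rw [Definable₁]
  convert h.exists_of_finite using 1
  ext x
  simp only [mem_singleton_iff, mem_ofPred_eq, Sum.elim_inr, Sum.elim_inl]
  rw [eq_div_iff hn]
  have hsum : ∀ u : Fin C.ncard → N, (∀ i, u i ∈ C) → (∀ i k, u i = u k → i = k) →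
      ∑ i, u i = ∑ c ∈ hC.toFinset, c := by
    intro u hu hinj
    have himg : Finset.univ.map ⟨u, fun i k => hinj i k⟩ = hC.toFinset := by
      refine Finset.eq_of_subset_of_card_le (fun c hc => ?_) ?_
      · obtain ⟨i, -, rfl⟩ := Finset.mem_map.1 hc
        exact hC.mem_toFinset.2 (hu i)
      · simp [ncard_eq_toFinset_card C hC]
    rw [← himg, Finset.sum_map]
    rfl
  constructor
  · intro hx
    have e : C ≃ Fin C.ncard := by
      have := hC.fintype
      exact (Fintype.equivFin C).trans (finCongr (by rw [← Nat.card_eq_fintype_card]; rfl))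
    have h1 : ∀ i, (fun i => (e.symm i : N)) i ∈ C := fun i => (e.symm i).2
    have h2 : ∀ i k, (fun i => (e.symm i : N)) i = (fun i => (e.symm i : N)) k → i = k :=
      fun i k hik => e.symm.injective (Subtype.ext hik)
    exact ⟨fun i => (e.symm i : N), h1, h2, by rw [hx, ← hsum _ h1 h2]⟩
  · rintro ⟨u, h1, h2, h3⟩
    rw [h3, hsum u h1 h2]

variable [CharZero N]

theorem IsValuedFieldStructure.definable_rvEq (hV : IsValuedFieldStructure ι V) (hn : 1 ≤ n)
    {f g : (α → N) → N} (hf : A.DefinableFun L f) (hg : A.DefinableFun L g) :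
    A.Definable L {x | RVEq V n (f x) (g x)} := by
  simp only [rvEq_iff hn]
  exact (hf.ofPred_eq hg).union (hV.definable_lt (hV.definableFun_sub hf hg)
    (hV.definableFun_mul (hV.definableFun_natCast n) hf))

end Definability

/-! ### Sets maximal for their induced structure on leading terms -/

section Core

open FirstOrder.Language Set

variable {L : FirstOrder.Language.{u, v}} {N : Type w} [L.Structure N]
  [Field N] {V : ValuationSubring N} {ι : valLanguage →ᴸ L} {B M : Set N}

/-- The hypothesis common to `0`-h-minimality and `0`-h^mix-minimality, for one model. -/
def PreparesRV (L : FirstOrder.Language.{u, v}) {N : Type w} [L.Structure N] [Field N]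
    (V : ValuationSubring N) : Prop :=
  ∀ (A X : Set N) (n : ℕ), 1 ≤ n → DefinableWithRV L V (V.valuation (n : N)) A X →
    ∃ (C : Set N) (m : ℕ), 1 ≤ m ∧ C.Finite ∧ A.Definable₁ L C ∧
      Prepares V (V.valuation (m : N)) C X

/-- `M` induces no more structure on the sorts `RV_{|n|}` than `B` does. -/
def RVDetermined (L : FirstOrder.Language.{u, v}) {N : Type w} [L.Structure N] [Field N]
    (V : ValuationSubring N) (B M : Set N) : Prop :=
  ∀ n : ℕ, 1 ≤ n → ∀ W : Set N, M.Definable₁ L W → (∀ x y, RVEq V n x y → x ∈ W → y ∈ W) →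
    B.Definable₁ L W

/-- `M` is maximal among the sets that induce no more structure on the sorts `RV_{|n|}` than
`B` does. -/
structure IsRVMaximal (L : FirstOrder.Language.{u, v}) {N : Type w} [L.Structure N] [Field N]
    (V : ValuationSubring N) (B M : Set N) : Prop where
  subset : B ⊆ M
  determined : RVDetermined L V B M
  mem_of_insert : ∀ a, RVDetermined L V B (insert a M) → a ∈ M

/-- Zorn applies because a definable set uses finitely many parameters, which all lie in one member
of a chain. -/
theorem exists_isRVMaximal (L : FirstOrder.Language.{u, v}) [L.Structure N]
    (V : ValuationSubring N) (B : Set N) : ∃ M, IsRVMaximal L V B M := by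
  obtain ⟨M, hBM, hM⟩ := zorn_subset_nonempty {M : Set N | RVDetermined L V B M} (by
    intro c hc hchain hne
    refine ⟨⋃₀ c, fun n hn W hW hinv => ?_, fun M hM => subset_sUnion_of_mem hM⟩
    obtain ⟨A, hA, hAW⟩ := definable_iff_finitely_definable.1 hW
    obtain ⟨M, hM, hAM⟩ := hchain.directedOn.exists_mem_subset_of_finset_subset_biUnion hne
      (f := id) (s := A) (by simpa [sUnion_eq_biUnion] using hA)
    exact hc hM n hn W (hAW.mono hAM) hinv) B (fun n _ W hW _ => hW)
  exact ⟨M, hBM, hM.prop, fun a ha => hM.le_of_ge ha (subset_insert a M) (mem_insert a M)⟩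

namespace IsRVMaximal

/-- A parameter definable over `M` can be eliminated, so adjoining it defines nothing new. -/
theorem mem_of_definable_singleton (hM : IsRVMaximal L V B M) {b : N}
    (hb : M.Definable₁ L {b}) : b ∈ M := by
  refine hM.mem_of_insert b fun n hn W hW hinv => hM.determined n hn W ?_ hinv
  obtain ⟨E, hE, hWE⟩ := exists_fibre_of_insert hW
  have : M.Definable L {x : Fin 1 → N | ∃ z, z ∈ ({b} : Set N) ∧ ![z, x 0] ∈ E} := by
    apply definable_setOf_exists
    exact (Definable₁.setOf_mem hb (DefinableFun.proj L)).inter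
      (setOf_mem_of_definable hE (DefinableFun.proj L) (DefinableFun.proj L))
  rw [Definable₁]
  convert this using 1
  ext x
  simp [hWE]

theorem mem_of_definableFun (hM : IsRVMaximal L V B M) {b : N}
    (hb : M.DefinableFun L fun _ : Fin 1 → N => b) : b ∈ M :=
  hM.mem_of_definable_singleton ((DefinableFun.proj L).ofPred_eq hb)

variable [CharZero N]

/-- Induction on the size `n` of `C`. The mean `a` of `C` lies in `M`. The leading terms of `c - a`
at level `|n|` form a `B`-definable set, so one of them is represented by some `b ∈ B`; the points
`c` with this leading term form a nonempty `M`-definable subset, which is proper unless `C` is a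
singleton. -/
theorem inter_nonempty_of_finite (hV : IsValuedFieldStructure ι V) (hB : L.MeetsDefinable B)
    (hM : IsRVMaximal L V B M) {C : Set N} (hC : C.Finite) (hdef : M.Definable₁ L C)
    (hne : C.Nonempty) : (C ∩ M).Nonempty := by
  induction h : C.ncard using Nat.strong_induction_on generalizing C with | _ n ih
  subst h
  have hn : 1 ≤ C.ncard := (ncard_pos hC).2 hne
  have hn0 : (C.ncard : N) ≠ 0 := by exact_mod_cast (Nat.one_le_iff_ne_zero.1 hn)
  set S := hC.toFinset with hS
  have haM : (∑ c ∈ S, c) / (C.ncard : N) ∈ M :=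
    hM.mem_of_definable_singleton (hV.definable_mean hC hdef hn0)
  have hcard : S.card = C.ncard := (ncard_eq_toFinset_card C hC).symm
  set a : N := (∑ c ∈ S, c) / C.ncard with ha
  by_cases hsub : C.Subsingleton
  · obtain ⟨c, rfl⟩ := hne.exists_eq_singleton_or_nontrivial.resolve_right
      (not_nontrivial_iff.2 hsub)
    exact ⟨c, rfl, hM.mem_of_definable_singleton hdef⟩
  have hca : M.DefinableFun L fun x : Fin 1 → N => x 0 - a :=
    hV.definableFun_sub (DefinableFun.proj L) (definableFun_const L _ haM)
  have hW : M.Definable₁ L {x | ∃ z, z ∈ C ∧ RVEq V C.ncard (z - a) x} := by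
    refine definable_setOf_exists (Definable.inter ?_ ?_)
    · exact Definable₁.setOf_mem hdef (DefinableFun.proj L)
    · exact hV.definable_rvEq hn (hV.definableFun_sub (DefinableFun.proj L)
        (definableFun_const L _ haM)) (DefinableFun.proj L)
  obtain ⟨b, ⟨c₀, hc₀, hcb⟩, hbB⟩ := hB {x | ∃ z, z ∈ C ∧ RVEq V C.ncard (z - a) x}
    (hne.elim fun c hc => ⟨c - a, c, hc, rfl⟩)
    (hM.determined _ hn _ hW fun x y hxy ⟨z, hz, hzx⟩ => ⟨z, hz, hzx.trans hxy⟩)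
  set C' : Set N := {c | c ∈ C ∧ RVEq V C.ncard (c - a) b} with hC'
  have hC'def : M.Definable₁ L C' :=
    hdef.inter (hV.definable_rvEq hn hca (definableFun_const L _ (hM.subset hbB)))
  have hC'sub : C' ⊆ C := fun c hc => hc.1
  by_cases hCC : C' = C
  · exfalso
    have hall : ∀ c ∈ C, RVEq V C.ncard (c - a) b := fun c hc => by
      rw [← hCC] at hc
      exact hc.2
    by_cases hb : b = 0
    · refine hsub fun c hc d hd => ?_
      have h0 : ∀ c ∈ C, c = a := fun c hc => by
        have := (hall c hc).valuation_eq hn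
        rw [hb, map_zero, map_eq_zero, sub_eq_zero] at this
        exact this
      rw [h0 c hc, h0 d hd]
    -- If every `c - a` has the leading term of `b`, each `c - a - b` has value below `|n b|`, yet
    -- these elements sum to `-n b` because `a` is the mean.
    · have hnb : V.valuation (C.ncard * b) ≠ 0 := by
        rw [V.valuation.ne_zero_iff]
        exact mul_ne_zero hn0 hb
      have hlt : V.valuation (∑ c ∈ S, (c - a - b)) < V.valuation (C.ncard * b) := by
        refine V.valuation.map_sum_lt hnb fun c hc => ?_
        have hc : c ∈ C := by simpa [hS] using hc
        rcases (rvEq_iff hn).1 (hall c hc) with h | h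
        · rw [h, sub_self, map_zero]
          exact zero_lt_iff.2 hnb
        · rwa [map_mul, (hall c hc).valuation_eq hn, ← map_mul] at h
      have hsum : ∑ c ∈ S, (c - a - b) = -(C.ncard * b) := by
        rw [Finset.sum_sub_distrib, Finset.sum_sub_distrib, Finset.sum_const, Finset.sum_const,
          hcard, nsmul_eq_mul, nsmul_eq_mul, ha, mul_div_cancel₀ _ hn0]
        ring
      rw [hsum, Valuation.map_neg] at hlt
      exact lt_irrefl _ hlt
  · obtain ⟨c, hc, hcM⟩ := ih C'.ncard (ncard_lt_ncard (hC'sub.ssubset_of_ne hCC) hC)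
      (hC.subset hC'sub) hC'def ⟨c₀, hc₀, hcb⟩ rfl
    exact ⟨c, hC'sub hc, hcM⟩

/-- The points of `C` outside `M` form a finite `M`-definable set disjoint from `M`, so there are
none. -/
theorem subset_of_finite (hV : IsValuedFieldStructure ι V) (hB : L.MeetsDefinable B)
    (hM : IsRVMaximal L V B M) {C : Set N} (hC : C.Finite) (hdef : M.Definable₁ L C) :
    C ⊆ M := by
  have hfin : (C ∩ M).Finite := hC.subset inter_subset_left
  have hdef' : M.Definable₁ L (C \ (C ∩ M)) := by
    have h1 : M.Definable₁ L (C ∩ M) := by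
      have := definable_biUnion_finset (L := L) (A := M) (f := fun c : ↥(C ∩ M) =>
        {x : Fin 1 → N | x 0 ∈ ({c.1} : Set N)})
        (fun c => Definable.singleton_of_mem L c.2.2) (@Finset.univ _ hfin.fintype)
      rw [Definable₁]
      convert this using 1
      ext x
      simp
    exact Definable.sdiff hdef h1
  by_contra hn
  obtain ⟨c, hc, hcM⟩ := not_subset.1 hn
  obtain ⟨d, hd, hdM⟩ := hM.inter_nonempty_of_finite hV hB (hC.subset sdiff_subset) hdef'
    ⟨c, hc, fun h => hcM h.2⟩
  exact hd.2 ⟨hd.1, hdM⟩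

end IsRVMaximal

end Core

/-! ### Best approximations from a maximal set -/

section BestApprox

open FirstOrder.Language Set

variable {L : FirstOrder.Language.{u, v}} {N : Type w} [L.Structure N]

theorem IsSaturated.exists_mem_forall {κ : Cardinal.{w}} (hsat : IsSaturated L κ N) {A : Set N}
    (hA : #A < κ) {𝒳 : Set (Set N)} (h𝒳 : ∀ X ∈ 𝒳, A.Definable₁ L X)
    (hfip : ∀ 𝒴 ⊆ 𝒳, 𝒴.Finite → (⋂₀ 𝒴).Nonempty) : ∃ x : N, ∀ X ∈ 𝒳, x ∈ X := by
  refine IsSaturated.exists_forall_mem (ElementaryEmbedding.refl L N) hsat hA (fun X hX => ?_) hfip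
  have : (ElementaryEmbedding.refl L N : N → N) '' A = A := image_id A
  rw [this]
  exact h𝒳 X hX

variable [Field N] {V : ValuationSubring N} {ι : valLanguage →ᴸ L} {B M : Set N}

/-- No element of `M` is closest to `α`. -/
def HasNoBestApprox (V : ValuationSubring N) (M : Set N) (α : N) : Prop :=
  ∀ a ∈ M, ∃ a' ∈ M, V.valuation (α - a') < V.valuation (α - a)

theorem IsRVMaximal.sub_mem (hV : IsValuedFieldStructure ι V) (hM : IsRVMaximal L V B M) {a b : N}
    (ha : a ∈ M) (hb : b ∈ M) : a - b ∈ M :=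
  hM.mem_of_definableFun
    (hV.definableFun_sub (definableFun_const L _ ha) (definableFun_const L _ hb))

theorem IsRVMaximal.add_mem (hV : IsValuedFieldStructure ι V) (hM : IsRVMaximal L V B M) {a b : N}
    (ha : a ∈ M) (hb : b ∈ M) : a + b ∈ M :=
  hM.mem_of_definableFun
    (hV.definableFun_add (definableFun_const L _ ha) (definableFun_const L _ hb))

/-- Otherwise the values `|α - a| ≤ |α - c|` with `a ∈ M` all lie between `|m(α - c)|` and `|α -
c|`. Finite ramification leaves finitely many, and the least one gives a closest point. -/
theorem HasNoBestApprox.exists_valuation_lt {α : N} (hα : HasNoBestApprox V M α) {m : ℕ}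
    (hfr : IsFinitelyRamified V m) {c : N} (hc : c ∈ M) :
    ∃ a ∈ M, V.valuation (α - a) < V.valuation (m * (α - c)) := by
  by_contra! hcon
  have hc0 : V.valuation (α - c) ≠ 0 := by
    obtain ⟨a', -, h⟩ := hα c hc
    exact (zero_le.trans_lt h).ne'
  let S : Set V.ValueGroup := {γ | (∃ a ∈ M, γ = V.valuation (α - a)) ∧ γ ≤ V.valuation (α - c)}
  have hfin : S.Finite := by
    refine (hfr.image fun γ => γ * V.valuation (α - c)).subset ?_
    rintro _ ⟨⟨a, ha, rfl⟩, hle⟩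
    refine ⟨V.valuation (α - a) / V.valuation (α - c), ⟨?_, ?_⟩, div_mul_cancel₀ _ hc0⟩
    · rw [le_div_iff₀ (zero_lt_iff.2 hc0), ← map_mul]
      exact hcon a ha
    · exact (div_le_one₀ (zero_lt_iff.2 hc0)).2 hle
  obtain ⟨γ, ⟨⟨a, ha, rfl⟩, hle⟩, hmin⟩ :=
    exists_min_image S id hfin ⟨_, ⟨c, hc, rfl⟩, le_rfl⟩
  obtain ⟨a', ha', hlt⟩ := hα a ha
  exact hlt.not_ge (hmin _ ⟨⟨a', ha', rfl⟩, hlt.le.trans hle⟩)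

theorem HasNoBestApprox.exists_forall_valuation_lt {α : N} (hα : HasNoBestApprox V M α) {m : ℕ}
    (hfr : IsFinitelyRamified V m) (hne : M.Nonempty) {C : Set N} (hC : C.Finite)
    (hCM : C ⊆ M) : ∃ a ∈ M, ∀ c ∈ C, V.valuation (α - a) < V.valuation (m * (α - c)) := by
  induction C, hC using Finite.induction_on with
  | empty =>
    obtain ⟨a, ha⟩ := hne
    exact ⟨a, ha, by simp⟩
  | @insert c C _ _ ih =>
    obtain ⟨a, ha, h1⟩ := ih ((subset_insert _ _).trans hCM)
    obtain ⟨a', ha', h2⟩ := hα.exists_valuation_lt hfr (hCM (mem_insert _ _))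
    rcases le_total (V.valuation (α - a)) (V.valuation (α - a')) with h | h
    · refine ⟨a, ha, ?_⟩
      rintro d (rfl | hd)
      · exact h.trans_lt h2
      · exact h1 d hd
    · refine ⟨a', ha', ?_⟩
      rintro d (rfl | hd)
      · exact h2
      · exact h.trans_lt (h1 d hd)

variable [CharZero N]

namespace IsRVMaximal

/-- The leading term class of `a` is a nonempty `B`-definable set, hence meets `B`. -/
theorem exists_valuation_eq (hV : IsValuedFieldStructure ι V) (hB : L.MeetsDefinable B)
    (hM : IsRVMaximal L V B M) {a : N} (ha : a ∈ M) : ∃ b ∈ B, V.valuation a = V.valuation b := by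
  have hW : M.Definable₁ L {x | RVEq V 1 a x} :=
    hV.definable_rvEq le_rfl (definableFun_const L _ ha) (DefinableFun.proj L)
  obtain ⟨b, hb, hbB⟩ := hB {x | RVEq V 1 a x} ⟨a, rfl⟩
    (hM.determined 1 le_rfl _ hW fun x y hxy hx => hx.trans hxy)
  exact ⟨b, hbB, RVEq.valuation_eq le_rfl hb⟩

/-- For `a' ∈ M` closer to `α` than `a`, one has `|α - a| = |a' - a|`, the value of an element of
`M`. -/
theorem exists_valuation_sub_eq (hV : IsValuedFieldStructure ι V) (hB : L.MeetsDefinable B)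
    (hM : IsRVMaximal L V B M) {α : N} (hα : HasNoBestApprox V M α) {a : N} (ha : a ∈ M) :
    ∃ b ∈ B, V.valuation (α - a) = V.valuation b := by
  obtain ⟨a', ha', hlt⟩ := hα a ha
  obtain ⟨b, hb, hab⟩ := hM.exists_valuation_eq hV hB (hM.sub_mem hV ha' ha)
  refine ⟨b, hb, ?_⟩
  rw [← hab, show α - a = (α - a') + (a' - a) by ring]
  refine V.valuation.map_add_eq_of_lt_right ?_
  rw [show a' - a = -(α - a') + (α - a) by ring]
  refine hlt.trans_eq (V.valuation.map_add_eq_of_lt_right ?_).symm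
  rwa [Valuation.map_neg]

end IsRVMaximal

/-- Each fibre of a definable family over an `RV`-sort is constant on a small ball around `α`. -/
theorem HasNoBestApprox.exists_forall_mem_iff (hV : IsValuedFieldStructure ι V)
    (hp : PreparesRV L V) (hfr : ∀ m, 1 ≤ m → IsFinitelyRamified V m)
    (hB : L.MeetsDefinable B) (hM : IsRVMaximal L V B M) {α : N} (hα : HasNoBestApprox V M α)
    {n : ℕ} (hn : 1 ≤ n) {E : Set (Fin 2 → N)} (hE : M.Definable L E)
    (hinv : ∀ x y y', RVEq V n y y' → ![x, y] ∈ E → ![x, y'] ∈ E) (y : N) :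
    ∃ a ∈ M, ∀ x, V.valuation (x - a) ≤ V.valuation (α - a) → (![x, y] ∈ E ↔ ![α, y] ∈ E) := by
  obtain ⟨C, m, hm, hC, hCdef, hprep⟩ := hp _ _ n hn (definableWithRV_fibre hE hinv y)
  have hne : M.Nonempty := by
    obtain ⟨b, -, hb⟩ := hB univ univ_nonempty definable_univ
    exact ⟨b, hM.subset hb⟩
  -- The ball of radius `|α - a|` around `a` is so small that `rv_{|m|}(x - c)` is constant on it
  -- for each `c` in the preparing set.
  obtain ⟨a, ha, hac⟩ := hα.exists_forall_valuation_lt (hfr m hm) hne hC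
    (hM.subset_of_finite hV hB hC hCdef)
  refine ⟨a, ha, fun x hx => (hprep α x fun c hc => ?_).symm⟩
  refine rvEq_of_le_of_lt hm ?_ (hac c hc)
  rw [show α - c - (x - c) = (α - a) - (x - a) by ring]
  exact (V.valuation.map_sub _ _).trans (max_le le_rfl hx)

/-- The fibrewise statement gives a ball depending on `y`. If no single ball worked for all `y`,
saturation of `N` would produce one `y` whose fibre is constant on none of these balls. -/
theorem HasNoBestApprox.exists_forall_mem_iff_uniform (hV : IsValuedFieldStructure ι V)
    (hp : PreparesRV L V) (hfr : ∀ m, 1 ≤ m → IsFinitelyRamified V m)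
    {κ : Cardinal.{w}} (hsat : IsSaturated L κ N) (hκ : ℵ₀ ≤ κ) (hBκ : #B < κ)
    (hB : L.MeetsDefinable B) (hM : IsRVMaximal L V B M) {α : N} (hα : HasNoBestApprox V M α)
    {n : ℕ} (hn : 1 ≤ n) {E : Set (Fin 2 → N)} (hE : M.Definable L E)
    (hinv : ∀ x y y', RVEq V n y y' → ![x, y] ∈ E → ![x, y'] ∈ E) :
    ∃ a ∈ M, ∀ y, ![a, y] ∈ E ↔ ![α, y] ∈ E := by
  obtain ⟨A₀, hA₀, hEA₀⟩ := definable_iff_finitely_definable.1 hE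
  -- No bound on the size of `M` is available, so the balls are indexed by radii represented in `B`,
  -- with one chosen centre `s b ∈ M` for each.
  let P : Set N := {b | b ∈ B ∧ ∃ a ∈ M, V.valuation (α - a) = V.valuation b}
  choose s hsM hs using fun b : P => b.2.2
  let A : Set N := ↑A₀ ∪ (range s ∪ B)
  have hPB : #P ≤ #B := mk_le_mk_of_subset fun b hb => hb.1
  have hA : #A < κ := by
    refine (mk_union_le _ _).trans_lt (add_lt_of_lt hκ ?_ ((mk_union_le _ _).trans_lt
      (add_lt_of_lt hκ (mk_range_le.trans hPB |>.trans_lt hBκ) hBκ)))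
    exact (lt_aleph0_of_finite _).trans_le hκ
  let S : P → Set N := fun b =>
    {y | (∃ x, V.valuation (x - s b) ≤ V.valuation (b : N) ∧ ![x, y] ∈ E) ∧
      ∃ x, V.valuation (x - s b) ≤ V.valuation (b : N) ∧ ![x, y] ∉ E}
  have hSdef : ∀ b, A.Definable₁ L (S b) := by
    intro b
    have hEA : A.Definable L E := hEA₀.mono subset_union_left
    have hle : A.Definable L {w : Fin 1 ⊕ Fin 1 → N |
        V.valuation (w (Sum.inr 0) - s b) ≤ V.valuation (b : N)} :=
      hV.definable_le (hV.definableFun_sub (DefinableFun.proj L)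
        (definableFun_const L _ (Or.inr (Or.inl ⟨b, rfl⟩))))
        (definableFun_const L _ (Or.inr (Or.inr b.2.1)))
    have hmem : A.Definable L {w : Fin 1 ⊕ Fin 1 → N | ![w (Sum.inr 0), w (Sum.inl 0)] ∈ E} :=
      setOf_mem_of_definable hEA (DefinableFun.proj L) (DefinableFun.proj L)
    exact definable_setOf_and (definable_setOf_exists (hle.inter hmem))
      (definable_setOf_exists (hle.inter hmem.compl))
  have hball : ∀ b x, V.valuation (x - s b) ≤ V.valuation (b : N) ↔
      V.valuation (x - α) ≤ V.valuation (b : N) := by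
    intro b x
    have h1 : V.valuation (s b - α) ≤ V.valuation (b : N) := by
      rw [Valuation.map_sub_swap, hs b]
    constructor <;> intro h
    · rw [show x - α = (x - s b) + (s b - α) by ring]
      exact V.valuation.map_add_le h h1
    · rw [show x - s b = (x - α) - (s b - α) by ring]
      exact V.valuation.map_sub_le h h1
  by_cases hex : ∃ b, S b = ∅
  · obtain ⟨b, hb⟩ := hex
    refine ⟨s b, hsM b, fun y => ?_⟩
    have h1 : V.valuation (s b - s b) ≤ V.valuation (b : N) := by simp
    have h2 : V.valuation (α - s b) ≤ V.valuation (b : N) := (hs b).le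
    have h3 : y ∉ S b := by simp [hb]
    constructor <;> intro h <;> by_contra h'
    · exact h3 ⟨⟨_, h1, h⟩, _, h2, h'⟩
    · exact h3 ⟨⟨_, h2, h⟩, _, h1, h'⟩
  exfalso
  push Not at hex
  obtain ⟨y, hy⟩ := hsat.exists_mem_forall hA (𝒳 := range S) (by
    rintro _ ⟨b, rfl⟩
    exact hSdef b) (by
    intro 𝒴 h𝒴 hfin
    obtain ⟨P₀, -, hP₀, rfl⟩ := exists_subset_image_finite_and.1
      ⟨𝒴, by rwa [image_univ], hfin, rfl⟩
    rcases P₀.eq_empty_or_nonempty with rfl | hne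
    · simp
    -- All the balls contain `α`, hence are nested: nonconstancy on the smallest of finitely many
    -- implies it on the others.
    · obtain ⟨b, hb, hmin⟩ := exists_min_image P₀ (fun b => V.valuation (b : N)) hP₀ hne
      obtain ⟨y, ⟨x, hx, hxE⟩, x', hx', hxE'⟩ := hex b
      refine ⟨y, ?_⟩
      rintro _ ⟨c, hc, rfl⟩
      exact ⟨⟨x, (hball _ _).2 (((hball _ _).1 hx).trans (hmin c hc)), hxE⟩,
        x', (hball _ _).2 (((hball _ _).1 hx').trans (hmin c hc)), hxE'⟩)
  obtain ⟨a, ha, hay⟩ := hα.exists_forall_mem_iff hV hp hfr hB hM hn hE hinv y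
  obtain ⟨b, hb, hab⟩ := hM.exists_valuation_sub_eq hV hB hα ha
  obtain ⟨⟨x, hx, hxE⟩, x', hx', hxE'⟩ := hy _ ⟨⟨b, hb, a, ha, hab⟩, rfl⟩
  have hball' : ∀ x, V.valuation (x - α) ≤ V.valuation b →
      V.valuation (x - a) ≤ V.valuation (α - a) := by
    intro x hx
    rw [show x - a = (x - α) + (α - a) by ring]
    exact V.valuation.map_add_le (hx.trans hab.ge) le_rfl
  exact hxE' ((hay x' (hball' _ ((hball _ _).1 hx'))).2
    ((hay x (hball' _ ((hball _ _).1 hx))).1 hxE))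

theorem IsRVMaximal.exists_best_approx (hV : IsValuedFieldStructure ι V)
    (hp : PreparesRV L V) (hfr : ∀ m, 1 ≤ m → IsFinitelyRamified V m)
    {κ : Cardinal.{w}} (hsat : IsSaturated L κ N) (hκ : ℵ₀ ≤ κ) (hBκ : #B < κ)
    (hB : L.MeetsDefinable B) (hM : IsRVMaximal L V B M) (α : N) :
    ∃ a ∈ M, ∀ a' ∈ M, V.valuation (α - a) ≤ V.valuation (α - a') := by
  by_contra! hα
  have hαM : α ∈ M := by
    refine hM.mem_of_insert α fun n hn W hW hinv => ?_
    obtain ⟨E, hE, hWE⟩ := exists_fibre_of_insert hW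
    -- Only the fibre of `E` at `α` is known to be invariant, so every fibre is shrunk to its
    -- largest invariant subset.
    let E' : Set (Fin 2 → N) := {x | ∀ z, RVEq V n (x 1) z → ![x 0, z] ∈ E}
    have hE' : M.Definable L E' :=
      definable_setOf_forall (definable_setOf_imp
        (hV.definable_rvEq hn (DefinableFun.proj L) (DefinableFun.proj L))
        (setOf_mem_of_definable hE (DefinableFun.proj L) (DefinableFun.proj L)))
    have hinv' : ∀ x y y', RVEq V n y y' → ![x, y] ∈ E' → ![x, y'] ∈ E' :=
      fun x y y' hy h z hz => h z (hy.trans hz)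
    have hWE' : ∀ y, y ∈ W ↔ ![α, y] ∈ E' := fun y =>
      ⟨fun hy z hz => (hWE z).1 (hinv y z hz hy), fun h => (hWE y).2 (h y rfl)⟩
    obtain ⟨a, ha, haE⟩ := HasNoBestApprox.exists_forall_mem_iff_uniform hV hp hfr hsat hκ hBκ
      hB hM hα hn hE' hinv'
    refine hM.determined n hn W ?_ hinv
    have : M.Definable L {x : Fin 1 → N | ![a, x 0] ∈ E'} :=
      setOf_mem_of_definable hE' (definableFun_const L _ ha) (DefinableFun.proj L)
    rw [Definable₁]
    simpa only [hWE', haE] using this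
  obtain ⟨a', -, h⟩ := hα α hαM
  simp at h

/-- Let `C ⊆ M` prepare `X` at level `|m|`. As `|y - a| ≤ |y - c|` for `c ∈ C`, replacing `y - a` by
an element with the same leading term changes no `rv_{|m|}(y - c)`. So `W` can be taken to be all
`z` whose whole leading term class is translated by `a` into `X`; being invariant, it is
`B`-definable. -/
theorem IsRVMaximal.exists_definable_translate (hV : IsValuedFieldStructure ι V)
    (hp : PreparesRV L V) (hB : L.MeetsDefinable B) (hM : IsRVMaximal L V B M) {y a : N}
    (ha : a ∈ M) (hya : ∀ a' ∈ M, V.valuation (y - a) ≤ V.valuation (y - a')) {X : Set N}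
    (hX : M.Definable₁ L X) (hy : y ∈ X) :
    ∃ W : Set N, B.Definable₁ L W ∧ y - a ∈ W ∧ ∀ z ∈ W, a + z ∈ X := by
  obtain ⟨C, m, hm, hC, hCdef, hprep⟩ := hp M X 1 le_rfl (definableWithRV_of_definable₁ hX _)
  have hCM := hM.subset_of_finite hV hB hC hCdef
  refine ⟨{z | ∀ z', RVEq V m z z' → a + z' ∈ X}, hM.determined m hm _ ?_ ?_, ?_, ?_⟩
  · exact definable_setOf_forall (definable_setOf_imp
      (hV.definable_rvEq hm (DefinableFun.proj L) (DefinableFun.proj L))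
      (Definable₁.setOf_mem hX (hV.definableFun_add (definableFun_const L _ ha)
        (DefinableFun.proj L))))
  · exact fun x z hxz hx z' hz' => hx z' (hxz.trans hz')
  · intro z' hz'
    refine (hprep y (a + z') fun c hc => ?_).1 hy
    rcases (rvEq_iff hm).1 hz' with h | h
    · rw [← h, add_sub_cancel]
    · refine rvEq_of_le_of_lt hm (r := V.valuation (y - a - z')) ?_ (h.trans_le ?_)
      · rw [show y - c - (a + z' - c) = y - a - z' by ring]
      · rw [map_mul, map_mul]
        gcongr
        exact hya c (hCM hc)
  · exact fun z hz => hz z rfl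

end BestApprox

/-! ### Chains of balls in a saturated model -/

section Balls

open FirstOrder.Language Set

variable {N : Type w} [Field N] {V : ValuationSubring N}

/-- The radii occurring in an open (`t = true`) or closed (`t = false`) ball of radius `γ`. -/
def radii {Γ : Type*} [Preorder Γ] (γ : Γ) (t : Bool) : Set Γ :=
  if t then Iio γ else Iic γ

theorem isLowerSet_radii {Γ : Type*} [Preorder Γ] (γ : Γ) (t : Bool) : IsLowerSet (radii γ t) := by
  cases t
  · exact isLowerSet_Iic γ
  · exact isLowerSet_Iio γ

theorem zero_mem_radii {Γ : Type*} [LinearOrderedCommGroupWithZero Γ] {γ : Γ} (hγ : γ ≠ 0)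
    (t : Bool) : 0 ∈ radii γ t := by
  cases t
  · exact zero_le (a := γ)
  · exact zero_lt_iff.2 hγ

theorem valuation_sub_mem {I : Set V.ValueGroup} (hI : IsLowerSet I) {x y z : N}
    (h1 : V.valuation (x - y) ∈ I) (h2 : V.valuation (y - z) ∈ I) : V.valuation (x - z) ∈ I := by
  rw [show x - z = (x - y) + (y - z) by ring]
  refine hI (V.valuation.map_add _ _) ?_
  rcases max_choice (V.valuation (x - y)) (V.valuation (y - z)) with h | h <;> rwa [h]

theorem valuation_sub_mem_iff {I : Set V.ValueGroup} (hI : IsLowerSet I) {x y z : N}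
    (h : V.valuation (y - z) ∈ I) : V.valuation (x - y) ∈ I ↔ V.valuation (x - z) ∈ I :=
  ⟨fun h' => valuation_sub_mem hI h' h, fun h' => valuation_sub_mem hI h'
    (by rwa [Valuation.map_sub_swap])⟩

theorem subset_or_subset_of_valuation_sub_mem {I I' : Set V.ValueGroup} (hI : IsLowerSet I)
    (hI' : IsLowerSet I') {a a' : N} (h : V.valuation (a - a') ∈ I') :
    {x | V.valuation (x - a) ∈ I} ⊆ {x | V.valuation (x - a') ∈ I'} ∨
      {x | V.valuation (x - a') ∈ I'} ⊆ {x | V.valuation (x - a) ∈ I} := by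
  rcases hI.total hI' with hle | hle
  · exact Or.inl fun x hx => (valuation_sub_mem_iff hI' h).1 (hle hx)
  · exact Or.inr fun x hx => hle ((valuation_sub_mem_iff hI' h).2 hx)

variable {L : FirstOrder.Language.{u, v}} [L.Structure N] {ι : valLanguage →ᴸ L}

theorem IsValuedFieldStructure.definable₁_ball (hV : IsValuedFieldStructure ι V) {A : Set N}
    {a d : N} (ha : a ∈ A) (hd : d ∈ A) (t : Bool) :
    A.Definable₁ L {x | V.valuation (x - a) ∈ radii (V.valuation d) t} := by
  have h1 : A.DefinableFun L fun x : Fin 1 → N => x 0 - a :=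
    hV.definableFun_sub (DefinableFun.proj L) (definableFun_const L _ ha)
  cases t
  · exact hV.definable_le h1 (definableFun_const L _ hd)
  · exact hV.definable_lt h1 (definableFun_const L _ hd)

/-- The index set may be large, but balls of the chain with the same radius parameter and the same
type (open or closed) coincide, so at most `#(B × Bool) < κ` different balls occur. -/
theorem IsSaturated.exists_mem_balls (hV : IsValuedFieldStructure ι V) {κ : Cardinal.{w}}
    (hsat : IsSaturated L κ N) (hκ : ℵ₀ ≤ κ) {B : Set N} (hBκ : #B < κ) {I : Type*}
    (c d : I → N) (t : I → Bool) (hdB : ∀ i, d i ∈ B) (hd : ∀ i, d i ≠ 0)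
    (hc : ∀ i k, V.valuation (c i - c k) ∈ radii (V.valuation (d k)) (t k) ∨
      V.valuation (c k - c i) ∈ radii (V.valuation (d i)) (t i)) :
    ∃ x, ∀ i, V.valuation (x - c i) ∈ radii (V.valuation (d i)) (t i) := by
  let ball : I → Set N := fun i => {x | V.valuation (x - c i) ∈ radii (V.valuation (d i)) (t i)}
  have htotal : ∀ i k, ball i ⊆ ball k ∨ ball k ⊆ ball i := by
    intro i k
    rcases hc i k with h | h
    · exact subset_or_subset_of_valuation_sub_mem (isLowerSet_radii _ _) (isLowerSet_radii _ _) h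
    · exact (subset_or_subset_of_valuation_sub_mem (isLowerSet_radii _ _)
        (isLowerSet_radii _ _) h).symm
  let key : I → B × Bool := fun i => (⟨d i, hdB i⟩, t i)
  choose s hs using fun p : range key => p.2
  have hball : ∀ i, ball (s ⟨key i, i, rfl⟩) = ball i := by
    intro i
    set k := s ⟨key i, i, rfl⟩
    have hk : key k = key i := hs _
    have hdk : d k = d i := congrArg (fun p => (p.1 : N)) hk
    have htk : t k = t i := congrArg Prod.snd hk
    have h := hc i k
    rw [hdk, htk, Valuation.map_sub_swap, or_self] at h
    ext x
    change _ ∈ radii (V.valuation (d k)) (t k) ↔ _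
    rw [hdk, htk]
    exact valuation_sub_mem_iff (isLowerSet_radii _ _) h
  let A : Set N := range (fun p => c (s p)) ∪ B
  have hA : #A < κ := by
    refine (mk_union_le _ _).trans_lt (add_lt_of_lt hκ ?_ hBκ)
    refine mk_range_le.trans_lt ((mk_set_le _).trans_lt ?_)
    rw [mk_prod, lift_uzero]
    exact mul_lt_of_lt hκ hBκ ((lift_lt_aleph0.2 (lt_aleph0_of_finite Bool)).trans_le hκ)
  obtain ⟨x, hx⟩ := hsat.exists_mem_forall hA (𝒳 := range fun p => ball (s p)) (by
    rintro _ ⟨p, rfl⟩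
    exact hV.definable₁_ball (Or.inl ⟨p, rfl⟩) (Or.inr (hdB _)) _) (by
    intro 𝒴 h𝒴 hfin
    rcases 𝒴.eq_empty_or_nonempty with rfl | hne
    · simp
    · obtain ⟨Y, hY⟩ := hfin.exists_minimal hne
      obtain ⟨p, rfl⟩ := h𝒴 hY.prop
      refine ⟨c (s p), fun Z hZ => ?_⟩
      obtain ⟨q, rfl⟩ := h𝒴 hZ
      have hmem : c (s p) ∈ ball (s p) := by
        change V.valuation (c (s p) - c (s p)) ∈ radii (V.valuation (d (s p))) (t (s p))
        rw [sub_self, map_zero]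
        exact zero_mem_radii (by simpa using hd _) _
      rcases htotal (s p) (s q) with h | h
      · exact h hmem
      · exact hY.le_of_le hZ h hmem)
  exact ⟨x, fun i => (hball i).subset (hx _ ⟨_, rfl⟩)⟩

end Balls

/-! ### Elementarity, saturation and spherical completeness of the maximal set -/

section Main

open FirstOrder.Language Set

variable {L : FirstOrder.Language.{u, v}} {ι : valLanguage →ᴸ L}

section

variable {K : Type w} {N : Type w} [L.Structure K] [L.Structure N] [Field N] [CharZero N]
  {V : ValuationSubring N} {M : Set N} {j : K ↪ₑ[L] N}

/-- After translation by the closest point `a`, each condition `X` is implied by a condition `W X`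
over `K`, and `y - a` satisfies all of these. Saturation of `K` yields a common solution `x`, and `a
+ j x` works. -/
theorem IsRVMaximal.exists_mem_forall (hV : IsValuedFieldStructure ι V) (hp : PreparesRV L V)
    {κ : Cardinal.{w}} (hsat : IsSaturated L κ K) (hκ : ℵ₀ < κ)
    (hM : IsRVMaximal L V (range j) M) {y a : N} (ha : a ∈ M)
    (hya : ∀ a' ∈ M, V.valuation (y - a) ≤ V.valuation (y - a')) {𝒳 : Set (Set N)}
    (hcard : Cardinal.lift.{w} #𝒳 < κ)
    (h𝒳 : ∀ X ∈ 𝒳, M.Definable₁ L X) (hy : ∀ X ∈ 𝒳, y ∈ X) : ∃ x ∈ M, ∀ X ∈ 𝒳, x ∈ X := by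
  choose! W hWdef hyW hW using fun X hX => hM.exists_definable_translate hV hp
    (meetsDefinable_range j) ha hya (h𝒳 X hX) (hy X hX)
  choose! F hFj hF using fun X hX => definable_iff_finitely_definable.1 (hWdef X hX)
  -- Each condition uses finitely many parameters, so fewer than `κ` parameters of `K` suffice in
  -- total, `κ` being uncountable.
  let P : Set K := j ⁻¹' ⋃ X : 𝒳, (F X.1 : Set N)
  have hjP : ∀ X ∈ 𝒳, (F X : Set N) ⊆ j '' P := by
    intro X hX b hb
    obtain ⟨k, rfl⟩ := hFj X hX hb
    exact ⟨k, mem_iUnion.2 ⟨⟨X, hX⟩, hb⟩, rfl⟩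
  have hP : #P < κ := by
    refine (mk_preimage_of_injective _ _ j.injective).trans_lt ?_
    refine (mk_iUnion_le_sum_mk).trans_lt ?_
    refine (sum_le_lift_mk_mul_iSup _).trans_lt ?_
    refine mul_lt_of_lt hκ.le (by simpa using hcard) ((ciSup_le' fun X => ?_).trans_lt hκ)
    exact (lt_aleph0_of_finite _).le
  obtain ⟨x, hx⟩ := hsat.exists_forall_mem j hP (𝒳 := W '' 𝒳) (by
    rintro _ ⟨X, hX, rfl⟩
    exact (hF X hX).mono (hjP X hX)) (by
    intro 𝒴 h𝒴 _
    refine ⟨y - a, fun Z hZ => ?_⟩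
    obtain ⟨X, hX, rfl⟩ := h𝒴 hZ
    exact hyW X hX)
  exact ⟨a + j x, hM.add_mem hV ha (hM.subset ⟨x, rfl⟩),
    fun X hX => hW X hX _ (hx _ ⟨X, hX, rfl⟩)⟩

theorem IsRVMaximal.meetsDefinable (hV : IsValuedFieldStructure ι V) (hp : PreparesRV L V)
    (hM : IsRVMaximal L V (range j) M)
    (happrox : ∀ y, ∃ a ∈ M, ∀ a' ∈ M, V.valuation (y - a) ≤ V.valuation (y - a')) :
    L.MeetsDefinable M := by
  rintro X ⟨y, hy⟩ hX
  obtain ⟨a, ha, hya⟩ := happrox y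
  obtain ⟨W, hW, hyW, hWX⟩ :=
    hM.exists_definable_translate hV hp (meetsDefinable_range j) ha hya hX hy
  obtain ⟨b, hb, hbj⟩ := meetsDefinable_range j W ⟨_, hyW⟩ hW
  exact ⟨a + b, hWX b hb, hM.add_mem hV ha (hM.subset hbj)⟩

end

/-- Values between `|m|` and `1` in an elementary extension come from the smaller field. -/
theorem IsFinitelyRamified.map {K : Type w} {N : Type x} [L.Structure K] [L.Structure N] [Field K]
    [Field N] {VK : ValuationSubring K} {V : ValuationSubring N}
    (hK : IsValuedFieldStructure ι VK) (hV : IsValuedFieldStructure ι V) (j : K ↪ₑ[L] N) {m : ℕ}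
    (h : IsFinitelyRamified VK m) : IsFinitelyRamified V m := by
  choose e he using VK.valuation_surjective
  have hm : j (m : K) = (m : N) := map_natCast (toRingHom hK hV j) m
  have h1 : j 1 = 1 := map_one (toRingHom hK hV j)
  refine (h.image fun γ => V.valuation (j (e γ))).subset ?_
  rintro γ ⟨hγ, hγ1⟩
  obtain ⟨y, rfl⟩ := V.valuation_surjective γ
  by_contra hn
  -- A new value in this interval would make nonempty a set definable over the image of `K`: the
  -- elements whose value lies in the interval but differs from the finitely many old ones. It would
  -- then contain a point of `K`.
  let X : Set N := {x | (V.valuation (j m) ≤ V.valuation x ∧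
      V.valuation x ≤ V.valuation (j 1)) ∧
      ∀ γ : {γ : VK.ValueGroup | VK.valuation (m : K) ≤ γ ∧ γ ≤ 1},
        ¬ (V.valuation x ≤ V.valuation (j (e γ)) ∧ V.valuation (j (e γ)) ≤ V.valuation x)}
  have hdef : (range j).Definable₁ L X := by
    have := h.to_subtype
    have hx : (range j).DefinableFun L fun x : Fin 1 → N => x 0 := DefinableFun.proj L
    have hj : ∀ k, (range j).DefinableFun L fun _ : Fin 1 → N => j k :=
      fun k => definableFun_const L _ ⟨k, rfl⟩
    exact definable_setOf_and
      (definable_setOf_and (hV.definable_le (hj _) hx) (hV.definable_le hx (hj _)))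
      (definable_setOf_forall_finite fun γ =>
        (definable_setOf_and (hV.definable_le hx (hj _)) (hV.definable_le (hj _) hx)).compl)
  obtain ⟨_, ⟨⟨h2, h3⟩, h4⟩, x, rfl⟩ := meetsDefinable_range j X ⟨y, ⟨by rwa [hm], by
    rwa [h1, map_one]⟩, fun γ hγ => hn ⟨γ, γ.2, le_antisymm hγ.2 hγ.1⟩⟩ hdef
  rw [valuation_map_le_iff hK hV] at h2 h3
  rw [map_one] at h3
  refine h4 ⟨_, h2, h3⟩ ?_
  rw [valuation_map_le_iff hK hV, valuation_map_le_iff hK hV, he]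
  exact ⟨le_rfl, le_rfl⟩

section

variable {K : Type w} [Field K] {V : ValuationSubring K}

theorem valuation_natCast_eq_one_iff (n : ℕ) :
    V.valuation (n : K) = 1 ↔ (n : IsLocalRing.ResidueField V) ≠ 0 := by
  rw [← map_natCast (IsLocalRing.residue V) n, IsLocalRing.residue_ne_zero_iff_isUnit,
    V.valuation_eq_one_iff]
  simp

theorem isFinitelyRamified_of_valuation_eq_one {m : ℕ} (h : V.valuation (m : K) = 1) :
    IsFinitelyRamified V m := by
  refine (finite_singleton (1 : V.ValueGroup)).subset ?_
  rintro γ ⟨h1, h2⟩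
  rw [h] at h1
  exact le_antisymm h2 h1

/-- Values between `|mn|` and `|m|` are `|m|` times values between `|n|` and `1`. -/
theorem IsFinitelyRamified.mul [CharZero K] {m n : ℕ} (hm0 : m ≠ 0) (hm : IsFinitelyRamified V m)
    (hn : IsFinitelyRamified V n) : IsFinitelyRamified V (m * n) := by
  have hm0' : V.valuation (m : K) ≠ 0 := by simpa using hm0
  refine (hm.union (hn.image fun γ => V.valuation (m : K) * γ)).subset ?_
  rintro γ ⟨h1, h2⟩
  rcases le_total (V.valuation (m : K)) γ with h | h
  · exact Or.inl ⟨h, h2⟩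
  · refine Or.inr ⟨γ / V.valuation (m : K), ⟨?_, ?_⟩, mul_div_cancel₀ _ hm0'⟩
    · rw [le_div_iff₀ (zero_lt_iff.2 hm0'), mul_comm]
      simpa using h1
    · exact (div_le_one₀ (zero_lt_iff.2 hm0')).2 h

theorem IsFinitelyRamified.of_prime [CharZero K] {p : ℕ} (hp : p.Prime)
    [CharP (IsLocalRing.ResidueField V) p] (h : IsFinitelyRamified V p) {m : ℕ} (hm : 1 ≤ m) :
    IsFinitelyRamified V m := by
  obtain ⟨k, m', hm', rfl⟩ := Nat.exists_eq_pow_mul_and_not_dvd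
    (Nat.one_le_iff_ne_zero.1 hm) p hp.ne_one
  have hunit : IsFinitelyRamified V m' :=
    isFinitelyRamified_of_valuation_eq_one ((valuation_natCast_eq_one_iff m').2 fun h0 =>
      hm' ((CharP.cast_eq_zero_iff _ p m').1 h0))
  have hpow : IsFinitelyRamified V (p ^ k) := by
    induction k with
    | zero => exact isFinitelyRamified_of_valuation_eq_one (by simp)
    | succ k ih =>
      rw [pow_succ']
      exact h.mul hp.ne_zero (ih (Nat.one_le_iff_ne_zero.2
        (mul_ne_zero (pow_ne_zero _ hp.ne_zero) fun h0 => hm' (h0 ▸ dvd_zero p))))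
  exact hpow.mul (pow_ne_zero _ hp.ne_zero) hunit

end

/-- Bounds the number of conditions in a type, as `IsRVMaximal.exists_mem_forall` requires. -/
theorem mk_formula_lt {κ : Cardinal.{max u v w}} (hκ : ℵ₀ < κ)
    (hL : Cardinal.lift.{w} L.card < κ) {M : Type (max u v w)} (A : Set M) (hA : #A < κ) :
    #(L[[A]].Formula (Fin 1)) < κ := by
  have h1 : #(L[[A]].Formula (Fin 1)) ≤ #(Σ n, L[[A]].BoundedFormula (Fin 1) n) :=
    Cardinal.mk_le_of_injective (f := fun φ => ⟨0, φ⟩) fun φ ψ h => by simpa using h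
  refine (h1.trans BoundedFormula.card_le).trans_lt (max_lt hκ ?_)
  rw [card_withConstants]
  refine add_lt_of_lt hκ.le ?_ ?_
  · exact (lift_lt_aleph0.2 (lt_aleph0_of_finite (Fin 1))).trans hκ
  · simp only [lift_add, lift_lift]
    refine add_lt_of_lt hκ.le ?_ ?_
    · rwa [lift_umax.{max u v, w}]
    · rwa [lift_id'.{max u v, max u v w}]

/-- Radii are represented in the small set `B`, so the chain has a common point `y` in `N`. A
closest point `a` of `S` is at least as close to `y` as each centre, so it lies in every ball. -/
theorem isSphericallyComplete_of_embedding {S N : Type w} [Field S] [L.Structure S]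
    [Field N] [L.Structure N] {VS : ValuationSubring S} {V : ValuationSubring N}
    (hS : IsValuedFieldStructure ι VS) (hV : IsValuedFieldStructure ι V) (i : S ↪ₑ[L] N)
    {κ : Cardinal.{w}} (hsat : IsSaturated L κ N) (hκ : ℵ₀ ≤ κ) {B : Set N} (hBκ : #B < κ)
    (hval : ∀ x : S, ∃ b ∈ B, V.valuation (i x) = V.valuation b)
    (happrox : ∀ y, ∃ a : S, ∀ a' : S, V.valuation (y - i a) ≤ V.valuation (y - i a')) :
    IsSphericallyComplete VS := by
  have hsub : ∀ x y : S, i (x - y) = i x - i y := map_sub (toRingHom hS hV i)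
  intro 𝓑 h𝓑 hchain
  have hform : ∀ X : 𝓑, ∃ (c : S) (d : N) (t : Bool), d ∈ B ∧ d ≠ 0 ∧
      ∀ x, x ∈ X.1 ↔ V.valuation (i x - i c) ∈ radii (V.valuation d) t := by
    intro X
    obtain ⟨c, r, hr, h⟩ := h𝓑 X.1 X.2
    obtain ⟨e, rfl⟩ := VS.valuation_surjective r
    obtain ⟨d, hdB, hd⟩ := hval e
    have hd0 : d ≠ 0 := by
      rintro rfl
      rw [map_zero, map_eq_zero] at hd
      exact hr (by rw [(map_eq_zero (toRingHom hS hV i)).1 hd, map_zero])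
    rcases h with h | h
    · refine ⟨c, d, true, hdB, hd0, fun x => ?_⟩
      rw [h, ← hd, ← hsub]
      exact (lt_iff_lt_of_le_iff_le (valuation_map_le_iff hS hV i e (x - c))).symm
    · refine ⟨c, d, false, hdB, hd0, fun x => ?_⟩
      rw [h, ← hd, ← hsub]
      exact (valuation_map_le_iff hS hV i (x - c) e).symm
  choose c d t hdB hd0 hmem using hform
  have hcen : ∀ X, c X ∈ X.1 := fun X => by
    rw [hmem, sub_self, map_zero]
    exact zero_mem_radii (by simpa using hd0 X) _
  obtain ⟨y, hy⟩ := hsat.exists_mem_balls hV hκ hBκ (fun X => i (c X)) d t hdB hd0 fun X Y => by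
    rcases hchain.total X.2 Y.2 with h | h
    · exact Or.inl ((hmem Y _).1 (h (hcen X)))
    · exact Or.inr ((hmem X _).1 (h (hcen Y)))
  obtain ⟨a, ha⟩ := happrox y
  refine ⟨a, fun X hX => (hmem ⟨X, hX⟩ a).2 ?_⟩
  refine valuation_sub_mem (isLowerSet_radii _ _) ?_ (hy ⟨X, hX⟩)
  rw [Valuation.map_sub_swap]
  exact isLowerSet_radii _ _ (ha _) (hy ⟨X, hX⟩)

/-- A type over a small subset of `M` is realized in the saturated `N`, so it is enough to move such
a realization into `M`. -/
theorem isSaturated_of_exists_mem {M N : Type w} [L.Structure M] [L.Structure N]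
    (i : M ↪ₑ[L] N) {κ κ' : Cardinal.{w}} (hsat : IsSaturated L κ' N) (hκ : κ ≤ κ')
    (h : ∀ A : Set M, #A < κ → ∀ Φ : Set (L[[A]].Formula (Fin 1)), ∀ X : Φ → Set N,
      (∀ φ, (range i).Definable₁ L (X φ)) → ∀ y, (∀ φ, y ∈ X φ) → ∃ x, ∀ φ, i x ∈ X φ) :
    IsSaturated L κ M := by
  intro A hA Φ hΦ
  let φ' : Φ → L.Formula (A ⊕ Fin 1) := fun φ => BoundedFormula.constantsVarsEquiv φ.1
  let X : Φ → Set N := fun φ =>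
    {y | (φ' φ).Realize (Sum.elim (fun a : A => i a) fun _ => y)}
  have hX : ∀ φ x, i (x 0) ∈ X φ ↔ φ.1.Realize x := by
    intro φ x
    rw [realize_iff_constantsVarsEquiv, ← i.map_formula, Sum.comp_elim]
    apply iff_of_eq
    change Formula.Realize _ _ = _
    congr 2
    ext k
    exact congrArg (fun k => i (x k)) (Subsingleton.elim 0 k)
  have hdef : ∀ φ, (i '' A).Definable₁ L (X φ) := by
    intro φ
    refine definable_iff_exists_formula_sum.2
      ⟨(φ' φ).relabel (Sum.map (fun a : A => ⟨i a, a, a.2, rfl⟩) id), ?_⟩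
    ext y
    simp only [mem_ofPred_eq, Formula.realize_relabel, Sum.elim_comp_map, Function.comp_id]
    change Formula.Realize _ _ ↔ _
    apply iff_of_eq
    congr 2
    ext k
    exact congrArg y (Subsingleton.elim 0 k)
  obtain ⟨y, hy⟩ := hsat.exists_mem_forall (mk_image_le.trans_lt (hA.trans_le hκ)) (𝒳 := range X) (by
    rintro _ ⟨φ, rfl⟩
    exact hdef φ) (by
    intro 𝒴 h𝒴 hfin
    obtain ⟨Φ₀, -, hΦ₀, rfl⟩ := exists_subset_image_finite_and.1
      ⟨𝒴, by rwa [image_univ], hfin, rfl⟩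
    obtain ⟨x, hx⟩ := hΦ (hΦ₀.image Subtype.val).toFinset (by simp)
    refine ⟨i (x 0), ?_⟩
    rintro _ ⟨φ, hφ, rfl⟩
    exact (hX φ x).2 (hx φ (by simpa using hφ)))
  obtain ⟨x, hx⟩ := h A hA Φ X (fun φ => (hdef φ).mono (image_subset_range _ _)) y
    fun φ => hy _ ⟨φ, rfl⟩
  exact ⟨fun _ => x, fun φ hφ => (hX ⟨φ, hφ⟩ _).1 (hx _)⟩

end Main
end HenselMin

/-! ### Construction of the extension -/

open HenselMin FirstOrder.Language in
theorem mainTheorem3 {L : FirstOrder.Language.{u, v}} (ι : HenselMin.valLanguage →ᴸ L)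
    {K : Type w} [Field K] [CharZero K] [L.Structure K] (V : ValuationSubring K)
    (hK : HenselMin.IsValuedFieldStructure ι V)
    (h : (CharZero (IsLocalRing.ResidueField V) ∧
          HenselMin.IsZeroHMinimal.{u, v, max u v w} ι (L.completeTheory K)) ∨
        (∃ p : ℕ, p.Prime ∧ CharP (IsLocalRing.ResidueField V) p ∧
          HenselMin.IsFinitelyRamified V p ∧
          HenselMin.IsZeroHMixMinimal.{u, v, max u v w} ι (L.completeTheory K)))
    (κ : Cardinal.{max u v w}) :
    ∃ (M : Type (max u v w)) (_ : Field M) (_ : L.Structure M) (VM : ValuationSubring M),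
      HenselMin.IsValuedFieldStructure ι VM ∧ Nonempty (K ↪ₑ[L] M) ∧
        HenselMin.IsSaturated L κ M ∧ HenselMin.IsSphericallyComplete VM := by
  -- Saturation of `K'` must exceed `κ`, `ℵ₀` and the size of the language, since it is applied to a
  -- whole type with one parameter set per formula.
  let κ₁ : Cardinal.{max u v w} := Order.succ (max (max ℵ₀ κ) (Cardinal.lift.{w} L.card))
  have hκ₁ : ℵ₀ < κ₁ := Order.lt_succ_iff.2 ((le_max_left _ _).trans (le_max_left _ _))
  have hκκ₁ : κ ≤ κ₁ :=
    ((le_max_right _ _).trans (le_max_left _ _)).trans (Order.le_succ _)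
  have hLκ₁ : Cardinal.lift.{w} L.card < κ₁ := Order.lt_succ_iff.2 (le_max_right _ _)
  obtain ⟨K', _, ⟨j₁⟩, hsatK⟩ := exists_isSaturated.{u, v, w} L K κ₁
  have : Nonempty K' := ⟨j₁ 0⟩
  -- Types in `N` will use all of `K'` as parameters.
  let κ₂ : Cardinal.{max u v w} := max κ₁ (Order.succ #K')
  obtain ⟨N, _, ⟨j₂⟩, hsatN⟩ := exists_isSaturated.{u, v, max u v w} L K' κ₂
  have hκ₂ : ℵ₀ ≤ κ₂ := hκ₁.le.trans (le_max_left _ _)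
  let j : K ↪ₑ[L] N := j₂.comp j₁
  obtain ⟨_, W, hW⟩ := hK.exists_of_elementarilyEquivalent j.elementarilyEquivalent
  have : CharZero N := charZero_of_injective_ringHom (toRingHom hK hW j).injective
  have hval1 : ∀ n : ℕ, V.valuation (n : K) = 1 → W.valuation (n : N) = 1 := by
    intro n hn
    have hn1 : V.valuation (n : K) = V.valuation 1 := by rw [hn, map_one]
    have e1 : j (n : K) = (n : N) := map_natCast (toRingHom hK hW j) n
    have e2 : j 1 = 1 := map_one (toRingHom hK hW j)
    have h1 := (valuation_map_le_iff hK hW j _ _).2 hn1.le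
    have h2 := (valuation_map_le_iff hK hW j _ _).2 hn1.ge
    rw [e1, e2, map_one] at h1 h2
    exact le_antisymm h1 h2
  have hNT : N ⊨ L.completeTheory K :=
    j.elementarilyEquivalent.theory_model_iff.1 inferInstance
  obtain ⟨hp, hfrK⟩ : PreparesRV L W ∧ ∀ m : ℕ, 1 ≤ m → IsFinitelyRamified V m := by
    rcases h with ⟨hchar, hmin⟩ | ⟨p, hpp, hchar, hram, hmin⟩
    -- In residue characteristic `0` all levels `|n|` equal `1`, which reduces the first case to the
    -- hypotheses of the second.
    · have hV1 : ∀ n : ℕ, 1 ≤ n → V.valuation (n : K) = 1 := fun n hn =>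
        (valuation_natCast_eq_one_iff n).2 (by exact_mod_cast Nat.one_le_iff_ne_zero.1 hn)
      refine ⟨fun A X n hn hX => ?_, fun m hm => isFinitelyRamified_of_valuation_eq_one (hV1 m hm)⟩
      rw [hval1 n (hV1 n hn)] at hX
      obtain ⟨C, h1, h2, h3⟩ := hmin N W hW hNT A X hX
      exact ⟨C, 1, le_rfl, h1, h2, by rwa [Nat.cast_one, map_one]⟩
    · exact ⟨fun A X n hn hX => hmin N W hW hNT A X n hn hX, fun m hm => hram.of_prime hpp hm⟩
  have hfr : ∀ m : ℕ, 1 ≤ m → IsFinitelyRamified W m := fun m hm => (hfrK m hm).map hK hW j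
  obtain ⟨M, hM⟩ := exists_isRVMaximal L W (Set.range j₂)
  have hB := meetsDefinable_range j₂
  have hBκ : #(Set.range j₂) < κ₂ :=
    mk_range_le.trans_lt ((Order.lt_succ _).trans_le (le_max_right _ _))
  have happrox := hM.exists_best_approx hW hp hfr hsatN hκ₂ hBκ hB
  have hmeet := hM.meetsDefinable hW hp happrox
  let S := hmeet.toElementarySubstructure
  have hS : ∀ x, x ∈ S ↔ x ∈ M := fun x => by
    conv_rhs => rw [← hmeet.closure_eq_self]
    rfl
  have hrange : Set.range S.subtype = M := by
    ext x
    rw [← hS]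
    exact ⟨fun ⟨y, hy⟩ => hy ▸ y.2, fun hx => ⟨⟨x, hx⟩, rfl⟩⟩
  let j' : K' ↪ₑ[L] S :=
    ⟨fun k => ⟨j₂ k, (hS _).2 (hM.subset ⟨k, rfl⟩)⟩, fun n φ x => by
      rw [← S.subtype.map_formula, ← j₂.map_formula φ x]
      rfl⟩
  obtain ⟨_, VS, hVS⟩ := hW.exists_of_elementarilyEquivalent S.elementarilyEquivalent.symm
  refine ⟨S, inferInstance, inferInstance, VS, hVS, ⟨j'.comp j₁⟩, ?_, ?_⟩
  · refine isSaturated_of_exists_mem S.subtype hsatN (hκκ₁.trans (le_max_left _ _))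
      fun A hA Φ X hX y hy => ?_
    obtain ⟨a, ha, hya⟩ := happrox y
    obtain ⟨x, hx, hxX⟩ := hM.exists_mem_forall hW hp hsatK hκ₁ ha hya (𝒳 := Set.range X) (by
      rw [Cardinal.lift_id]
      exact (mk_range_le.trans (mk_set_le _)).trans_lt
        (mk_formula_lt hκ₁ hLκ₁ A (hA.trans_le hκκ₁))) (by
      rintro _ ⟨φ, rfl⟩
      exact hrange ▸ hX φ) (by
      rintro _ ⟨φ, rfl⟩
      exact hy φ)
    exact ⟨⟨x, (hS x).2 hx⟩, fun φ => hxX _ ⟨φ, rfl⟩⟩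
  · refine isSphericallyComplete_of_embedding hVS hW S.subtype hsatN hκ₂ hBκ
      (fun x => hM.exists_valuation_eq hW hB ((hS _).1 x.2)) fun y => ?_
    obtain ⟨a, ha, hya⟩ := happrox y
    exact ⟨⟨a, (hS a).2 ha⟩, fun a' => hya _ ((hS _).1 a'.2)⟩
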